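/- **Setting.** Let $X$ be a smooth manifold and let $\mathcal U=\{U_i\}$ be a good cover of $X$, i.e. an open cover all of whose nonempty finite intersections $U_{i_0\dots i_p}=U_{i_0}\cap\dots\cap U_{i_p}$ are contractible. Let $\mathcal E^q$ be the sheaf of smooth real $q$-forms, let $C^p(\mathcal U,\mathcal E^q)$ be the Čech cochains, and equip $F^m=\bigoplus_{p+q=m}C^p(\mathcal U,\mathcal E^q)$ (with $F^{-1}=0$) with the differential $D=\delta+(-1)^p d$ on $C^p(\mathcal U,\mathcal E^q)$. The global forms $\mathcal E^m(X)\subset C^0(\mathcal U,\mathcal E^m)$ and the integer cochains $C^m(\mathcal U,\mathbb Z)\subset C^m(\mathcal U,\mathcal E^0)$ are subgroups of $F^m$. For $a\in C^r(\mathcal U,\mathcal E^j)$ and $b\in C^s(\mathcal U,\mathcal E^m)$ put $$(a\cup b)_{i_0\dots i_{r+s}}=(-1)^{js}\,a_{i_0\dots i_r}\wedge b_{i_r\dots i_{r+s}},$$ and extend $\cup$ biadditively. For an integer $k\ge 0$, a smooth hyperspark of degree $k$ is an $a\in F^k$ with $Da=e-r$ for some $e\in\mathcal E^{k+1}(X)$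 and $r\in C^{k+1}(\mathcal U,\mathbb Z)$; these $e$ and $r$ are then unique. Two hypersparks $a,a'$ of degree $k$ are equivalent if $a-a'=Db+s$ for some $b\in F^{k-1}$ and $s\in C^k(\mathcal U,\mathbb Z)$. Let $\hat{\mathbf H}^k(X)$ be the group of equivalence classes, with the homomorphisms $\delta_1:\hat{\mathbf H}^k(X)\to\mathcal E^{k+1}(X)$, $[a]\mapsto e$, and $\delta_2:\hat{\mathbf H}^k(X)\to H^{k+1}(\mathcal U,\mathbb Z)=H^{k+1}(X,\mathbb Z)$, $[a]\mapsto[r]$. Let $\hat{\mathbf H}^k_\infty(X)\subset\hat{\mathbf H}^k(X)$ be the subgroup of the classes that are represented by a global smooth form $a\in\mathcal E^k(X)$, and let $H^k(X,\mathbb R/\mathbb Z)\subset\hat{\mathbf H}^k(X)$ denote the subgroup $\ker\delta_1$ of the classes of those $a\in F^k$ with $Da\in C^{k+1}(\mathcal U,\mathbb Z)$. For hypersparks $a$, $b$ of degrees $k$, $l$ with $Da=e-r$ and $Db=f-s$, the product of their classes is $$[a]\,[b]=[\,a\cup f+(-1)^{k+1}\,r\cup b\,]\in\hat{\mathbf H}^{k+l+1}(X);$$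 it is well defined and biadditive. **Lemma 5.7.** Let $k,l\ge 0$. If $\alpha\in\hat{\mathbf H}^k_\infty(X)$ and $\beta\in H^l(X,\mathbb R/\mathbb Z)=\ker\delta_1\subset\hat{\mathbf H}^l(X)$, then $\alpha\beta=0$. Likewise, if $\alpha\in\ker\delta_2\subset\hat{\mathbf H}^k(X)$ and $\beta\in\ker\delta_1\subset\hat{\mathbf H}^l(X)$, then $\alpha\beta=0$. -/

import Mathlib

set_option linter.unusedSectionVars false

open scoped Manifold ContDiff Topology DirectSum

namespace HyperSpark

open Equiv
open TopologicalSpace (Opens)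

section Prelim
open scoped Nat

section Wedge
variable {E : Type*} [AddCommGroup E] [Module ℝ E] [TopologicalSpace E]

theorem finiteDimensional_alt [FiniteDimensional ℝ E] (j : ℕ) :
    FiniteDimensional ℝ (E [⋀^Fin j]→L[ℝ] ℝ) :=
  Module.Finite.of_injective
    ((AlternatingMap.toMultilinearMapLM (R := ℝ) (S := ℝ) (M := E) (N := ℝ) (ι := Fin j)).comp
      (ContinuousAlternatingMap.toAlternatingMapLinear (R := ℝ) (A := ℝ) (M := E) (N := ℝ)
      (ι := Fin j)))
    (fun f g h => by
      ext v
      exact congrArg (fun F : MultilinearMap ℝ (fun _ : Fin j => E) ℝ => F v) h)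

theorem wedge_aux {j m : ℕ} (a : E [⋀^Fin j]→ₗ[ℝ] ℝ) (b : E [⋀^Fin m]→ₗ[ℝ] ℝ)
    (v : Fin (j + m) → E) :
    ((LinearMap.mul' ℝ ℝ).compAlternatingMap (a.domCoprod b)).domDomCongr finSumFinEquiv v =
      ((j ! * m ! : ℕ) : ℝ)⁻¹ * ∑ σ : Perm (Fin (j + m)), (Perm.sign σ : ℤ) *
        (a (fun i => v (σ (Fin.castAdd m i))) * b (fun i => v (σ (Fin.natAdd j i)))) := by
  have h := MultilinearMap.domCoprod_alternization_eq a b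
  have h2 := congrArg (fun F : E [⋀^Fin j ⊕ Fin m]→ₗ[ℝ] (TensorProduct ℝ ℝ ℝ) =>
    LinearMap.mul' ℝ ℝ (F (fun i => v (finSumFinEquiv i)))) h
  simp only [MultilinearMap.alternatization_apply, Fintype.card_fin, AlternatingMap.smul_apply,
    map_sum, MultilinearMap.domDomCongr_apply] at h2
  rw [eq_inv_mul_iff_mul_eq₀ (by positivity)]
  rw [map_nsmul, nsmul_eq_mul] at h2
  refine Eq.trans h2.symm ?_
  refine Fintype.sum_equiv (finSumFinEquiv.permCongr) _ _ fun σ => ?_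
  rw [Perm.sign_permCongr]
  rw [Units.smul_def, map_zsmul, zsmul_eq_mul]
  simp [MultilinearMap.domCoprod_apply, Equiv.permCongr_apply]

/-- The wedge product of alternating forms, normalised as the sum over shuffles. -/
noncomputable def wedge {j m : ℕ} (a : E [⋀^Fin j]→L[ℝ] ℝ) (b : E [⋀^Fin m]→L[ℝ] ℝ) :
    E [⋀^Fin (j + m)]→L[ℝ] ℝ :=
  { ((LinearMap.mul' ℝ ℝ).compAlternatingMap
      (a.toAlternatingMap.domCoprod b.toAlternatingMap)).domDomCongr finSumFinEquiv with
    cont := by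
      refine (?_ : Continuous fun v => ((LinearMap.mul' ℝ ℝ).compAlternatingMap
        (a.toAlternatingMap.domCoprod b.toAlternatingMap)).domDomCongr finSumFinEquiv v)
      simp only [wedge_aux]
      refine continuous_const.mul (continuous_finsetSum _ fun σ _ => continuous_const.mul ?_)
      exact (a.cont.comp (continuous_pi fun i => continuous_apply _)).mul
        (b.cont.comp (continuous_pi fun i => continuous_apply _)) }

theorem wedge_apply {j m : ℕ} (a : E [⋀^Fin j]→L[ℝ] ℝ) (b : E [⋀^Fin m]→L[ℝ] ℝ)
    (v : Fin (j + m) → E) :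
    wedge a b v = ((j ! * m ! : ℕ) : ℝ)⁻¹ * ∑ σ : Perm (Fin (j + m)), (Perm.sign σ : ℤ) *
        (a (fun i => v (σ (Fin.castAdd m i))) * b (fun i => v (σ (Fin.natAdd j i)))) :=
  wedge_aux _ _ v

theorem wedge_comp {E' : Type*} [AddCommGroup E'] [Module ℝ E'] [TopologicalSpace E'] {j m : ℕ}
    (a : E [⋀^Fin j]→L[ℝ] ℝ) (b : E [⋀^Fin m]→L[ℝ] ℝ) (L : E' →L[ℝ] E)
    (v : Fin (j + m) → E') :
    wedge (a.compContinuousLinearMap L) (b.compContinuousLinearMap L) v = wedge a b (L ∘ v) := by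
  rw [wedge_apply, wedge_apply]; rfl

/-- Signed sum over all permutations of the arguments of a function. -/
noncomputable def altSum {V : Type*} {N : ℕ} (F : (Fin N → V) → ℝ) (v : Fin N → V) : ℝ :=
  ∑ σ : Perm (Fin N), (Perm.sign σ : ℤ) * F (v ∘ σ)

theorem altSum_perm {V : Type*} {N : ℕ} (F : (Fin N → V) → ℝ) (τ : Perm (Fin N)) (v : Fin N → V) :
    altSum (fun w => F (w ∘ τ)) v = (Perm.sign τ : ℤ) * altSum F v := by
  unfold altSum
  rw [Finset.mul_sum]
  refine Fintype.sum_equiv (Equiv.mulRight τ) _ _ fun σ => ?_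
  have : ((Perm.sign τ : ℤ) : ℝ) * (Perm.sign τ : ℤ) = 1 := by
    exact_mod_cast Int.units_coe_mul_self _
  simp only [coe_mulRight, Perm.sign_mul, Units.val_mul, Int.cast_mul, Perm.coe_mul,
    Function.comp_assoc]
  linear_combination (-((Perm.sign σ : ℤ) : ℝ) * F (v ∘ σ ∘ τ)) * this

theorem altSum_sum {V ι : Type*} {N : ℕ} (s : Finset ι) (c : ι → ℝ) (F : ι → (Fin N → V) → ℝ)
    (v : Fin N → V) :
    altSum (fun w => ∑ i ∈ s, c i * F i w) v = ∑ i ∈ s, c i * altSum (F i) v := by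
  simp only [altSum, Finset.mul_sum]
  rw [Finset.sum_comm]
  exact Finset.sum_congr rfl fun i _ => Finset.sum_congr rfl fun σ _ => by ring

theorem altSum_const_mul {V : Type*} {N : ℕ} (c : ℝ) (F : (Fin N → V) → ℝ)
    (v : Fin N → V) :
    altSum (fun w => c * F w) v = c * altSum F v := by
  simp only [altSum, Finset.mul_sum]
  exact Finset.sum_congr rfl fun σ _ => by ring

theorem wedge_eq_altSum {j m : ℕ} (a : E [⋀^Fin j]→L[ℝ] ℝ) (b : E [⋀^Fin m]→L[ℝ] ℝ)
    (v : Fin (j + m) → E) :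
    wedge a b v = ((j ! * m ! : ℕ) : ℝ)⁻¹ *
      altSum (fun w => a (w ∘ Fin.castAdd m) * b (w ∘ Fin.natAdd j)) v :=
  wedge_apply a b v

theorem altSum_alternating {N : ℕ} (a : E [⋀^Fin N]→L[ℝ] ℝ) (v : Fin N → E) :
    altSum a v = N ! * a v := by
  unfold altSum
  have : ∀ σ : Perm (Fin N), ((Perm.sign σ : ℤ) : ℝ) * a (v ∘ σ) = a v := fun σ => by
    have h1 : a (v ∘ σ) = Perm.sign σ • a v := a.toAlternatingMap.map_perm v σ
    have : ((Perm.sign σ : ℤ) : ℝ) * (Perm.sign σ : ℤ) = 1 := by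
      exact_mod_cast Int.units_coe_mul_self _
    rw [h1, Units.smul_def, zsmul_eq_mul]
    linear_combination a v * this
  simp [this, Fintype.card_perm]

end Wedge

section Algebra
variable {E : Type*} [NormedAddCommGroup E] [NormedSpace ℝ E]

/-- The tuple with its `i`-th entry moved to the front is a permutation of sign `(-1) ^ i`. -/
theorem exists_perm_front {n : ℕ} (i : Fin (n + 1)) : ∃ τ : Perm (Fin (n + 1)),
    Perm.sign τ = (-1) ^ (i : ℕ) ∧ τ 0 = i ∧ ∀ t : Fin n, τ t.succ = i.succAbove t := by
  refine ⟨i.cycleRange⁻¹, by simp [Fin.sign_cycleRange], ?_, fun t => ?_⟩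
  · rw [Perm.inv_eq_iff_eq]; simp
  · rw [Perm.inv_eq_iff_eq]; simp [Fin.cycleRange_succAbove]

theorem neg_one_pow_mul_self' (i : ℕ) : ((-1 : ℝ) ^ i) * (-1) ^ i = 1 := by
  rw [← mul_pow]; simp

theorem altUncurry_eq_altSum {n : ℕ} (B : E →L[ℝ] E [⋀^Fin n]→L[ℝ] ℝ) (v : Fin (n + 1) → E) :
    ContinuousAlternatingMap.alternatizeUncurryFin B v =
      ((n ! : ℕ) : ℝ)⁻¹ * altSum (fun w => B (w 0) (w ∘ Fin.succ)) v := by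
  have h := altSum_alternating (ContinuousAlternatingMap.alternatizeUncurryFin B) v
  have h2 : altSum (ContinuousAlternatingMap.alternatizeUncurryFin B) v =
      (n + 1) * altSum (fun w => B (w 0) (w ∘ Fin.succ)) v := by
    have : (ContinuousAlternatingMap.alternatizeUncurryFin B : (Fin (n + 1) → E) → ℝ) =
        fun w => ∑ i : Fin (n + 1), (-1 : ℝ) ^ (i : ℕ) * B (w i) (i.removeNth w) := by
      ext w
      simp [ContinuousAlternatingMap.alternatizeUncurryFin_apply]
    rw [this, altSum_sum]
    have h3 : ∀ i : Fin (n + 1), (-1 : ℝ) ^ (i : ℕ) *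
        altSum (fun w => B (w i) (i.removeNth w)) v =
          altSum (fun w => B (w 0) (w ∘ Fin.succ)) v := fun i => by
      obtain ⟨τ, hs, h0, hτ⟩ := exists_perm_front i
      have h4 := altSum_perm (fun w => B (w 0) (w ∘ Fin.succ)) τ v
      have h5 : (fun w : Fin (n + 1) → E => B (w i) (i.removeNth w)) =
          fun w => B ((w ∘ τ) 0) ((w ∘ τ) ∘ Fin.succ) := by
        ext w
        simp only [Function.comp_apply, h0]
        congr 1
        ext t
        simp [Fin.removeNth, hτ]
      rw [h5, h4, hs]
      push_cast
      rw [← mul_assoc, neg_one_pow_mul_self', one_mul]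
    simp [h3]
  rw [h, Nat.factorial_succ] at h2
  have : ((n ! : ℕ) : ℝ) ≠ 0 := by positivity
  have h6 : (n + 1 : ℝ) ≠ 0 := by positivity
  rw [eq_inv_mul_iff_mul_eq₀ this]
  apply mul_left_cancel₀ h6
  rw [← h2]; push_cast; ring

/-- Permuting the first block of arguments. -/
theorem altSum_front {V : Type*} {j m : ℕ} (F : (Fin j → V) → (Fin m → V) → ℝ) (τ : Perm (Fin j))
    (v : Fin (j + m) → V) :
    altSum (fun w => F ((w ∘ Fin.castAdd m) ∘ τ) (w ∘ Fin.natAdd j)) v =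
      (Perm.sign τ : ℤ) * altSum (fun w => F (w ∘ Fin.castAdd m) (w ∘ Fin.natAdd j)) v := by
  have h := altSum_perm (fun w => F (w ∘ Fin.castAdd m) (w ∘ Fin.natAdd j))
    (finSumFinEquiv.permCongr (Perm.sumCongr τ 1)) v
  rw [Perm.sign_permCongr, Perm.sign_sumCongr] at h
  simp only [Perm.sign_one, mul_one] at h
  rw [← h]
  congr 1
  ext w
  congr 1 <;> ext t <;> simp [Equiv.permCongr_apply]

/-- Permuting the last block of arguments. -/
theorem altSum_back {V : Type*} {j m : ℕ} (F : (Fin j → V) → (Fin m → V) → ℝ) (τ : Perm (Fin m))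
    (v : Fin (j + m) → V) :
    altSum (fun w => F (w ∘ Fin.castAdd m) ((w ∘ Fin.natAdd j) ∘ τ)) v =
      (Perm.sign τ : ℤ) * altSum (fun w => F (w ∘ Fin.castAdd m) (w ∘ Fin.natAdd j)) v := by
  have h := altSum_perm (fun w => F (w ∘ Fin.castAdd m) (w ∘ Fin.natAdd j))
    (finSumFinEquiv.permCongr (Perm.sumCongr 1 τ)) v
  rw [Perm.sign_permCongr, Perm.sign_sumCongr] at h
  simp only [Perm.sign_one, one_mul] at h
  rw [← h]
  congr 1
  ext w
  congr 1 <;> ext t <;> simp [Equiv.permCongr_apply]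

/-- Permuting the arguments behind the first one. -/
theorem altSum_tail {V : Type*} {n : ℕ} (F : V → (Fin n → V) → ℝ) (τ : Perm (Fin n))
    (v : Fin (n + 1) → V) :
    altSum (fun w => F (w 0) ((w ∘ Fin.succ) ∘ τ)) v =
      (Perm.sign τ : ℤ) * altSum (fun w => F (w 0) (w ∘ Fin.succ)) v := by
  have h := altSum_perm (fun w => F (w 0) (w ∘ Fin.succ)) (Perm.decomposeFin.symm (0, τ)) v
  rw [Perm.decomposeFin.symm_sign] at h
  simp only [if_true, one_mul] at h
  rw [← h]
  congr 1

theorem altSum_cast {V : Type*} {N M : ℕ} (h : N = M) (F : (Fin N → V) → ℝ) (v : Fin M → V) :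
    altSum F (v ∘ Fin.cast h) = altSum (fun w => F (w ∘ Fin.cast h)) v := by
  subst h; rfl

theorem altSum_inner_front {V : Type*} {j m : ℕ} (F : (Fin j → V) → ℝ) (G : (Fin m → V) → ℝ)
    (v : Fin (j + m) → V) :
    altSum (fun w => altSum F (w ∘ Fin.castAdd m) * G (w ∘ Fin.natAdd j)) v =
      j ! * altSum (fun w => F (w ∘ Fin.castAdd m) * G (w ∘ Fin.natAdd j)) v := by
  have : (fun w : Fin (j + m) → V => altSum F (w ∘ Fin.castAdd m) * G (w ∘ Fin.natAdd j)) =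
      fun w => ∑ σ : Perm (Fin j), ((Perm.sign σ : ℤ) : ℝ) *
        (F ((w ∘ Fin.castAdd m) ∘ σ) * G (w ∘ Fin.natAdd j)) := by
    ext w; simp only [altSum, Finset.sum_mul]
    exact Finset.sum_congr rfl fun σ _ => by ring
  rw [this, altSum_sum]
  have h : ∀ σ : Perm (Fin j), ((Perm.sign σ : ℤ) : ℝ) *
      altSum (fun w => F ((w ∘ Fin.castAdd m) ∘ σ) * G (w ∘ Fin.natAdd j)) v =
      altSum (fun w => F (w ∘ Fin.castAdd m) * G (w ∘ Fin.natAdd j)) v := fun σ => by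
    rw [altSum_front (fun x y => F x * G y) σ v, ← mul_assoc]
    have : ((Perm.sign σ : ℤ) : ℝ) * (Perm.sign σ : ℤ) = 1 := by
      exact_mod_cast Int.units_coe_mul_self _
    rw [this, one_mul]
  simp [h, Fintype.card_perm]

theorem altSum_inner_back {V : Type*} {j m : ℕ} (F : (Fin j → V) → ℝ) (G : (Fin m → V) → ℝ)
    (v : Fin (j + m) → V) :
    altSum (fun w => F (w ∘ Fin.castAdd m) * altSum G (w ∘ Fin.natAdd j)) v =
      m ! * altSum (fun w => F (w ∘ Fin.castAdd m) * G (w ∘ Fin.natAdd j)) v := by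
  have : (fun w : Fin (j + m) → V => F (w ∘ Fin.castAdd m) * altSum G (w ∘ Fin.natAdd j)) =
      fun w => ∑ σ : Perm (Fin m), ((Perm.sign σ : ℤ) : ℝ) *
        (F (w ∘ Fin.castAdd m) * G ((w ∘ Fin.natAdd j) ∘ σ)) := by
    ext w; simp only [altSum, Finset.mul_sum]
    exact Finset.sum_congr rfl fun σ _ => by ring
  rw [this, altSum_sum]
  have h : ∀ σ : Perm (Fin m), ((Perm.sign σ : ℤ) : ℝ) *
      altSum (fun w => F (w ∘ Fin.castAdd m) * G ((w ∘ Fin.natAdd j) ∘ σ)) v =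
      altSum (fun w => F (w ∘ Fin.castAdd m) * G (w ∘ Fin.natAdd j)) v := fun σ => by
    rw [altSum_back (fun x y => F x * G y) σ v, ← mul_assoc]
    have : ((Perm.sign σ : ℤ) : ℝ) * (Perm.sign σ : ℤ) = 1 := by
      exact_mod_cast Int.units_coe_mul_self _
    rw [this, one_mul]
  simp [h, Fintype.card_perm]

theorem altSum_inner_tail {V : Type*} {n : ℕ} (F : V → (Fin n → V) → ℝ) (v : Fin (n + 1) → V) :
    altSum (fun w => altSum (F (w 0)) (w ∘ Fin.succ)) v =
      n ! * altSum (fun w => F (w 0) (w ∘ Fin.succ)) v := by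
  have : (fun w : Fin (n + 1) → V => altSum (F (w 0)) (w ∘ Fin.succ)) =
      fun w => ∑ σ : Perm (Fin n), ((Perm.sign σ : ℤ) : ℝ) * F (w 0) ((w ∘ Fin.succ) ∘ σ) := rfl
  rw [this, altSum_sum]
  have h : ∀ σ : Perm (Fin n), ((Perm.sign σ : ℤ) : ℝ) *
      altSum (fun w => F (w 0) ((w ∘ Fin.succ) ∘ σ)) v =
      altSum (fun w => F (w 0) (w ∘ Fin.succ)) v := fun σ => by
    rw [altSum_tail F σ v, ← mul_assoc]
    have : ((Perm.sign σ : ℤ) : ℝ) * (Perm.sign σ : ℤ) = 1 := by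
      exact_mod_cast Int.units_coe_mul_self _
    rw [this, one_mul]
  simp [h, Fintype.card_perm]

theorem altUncurry_wedge_left {j m : ℕ} (B : E →L[ℝ] E [⋀^Fin j]→L[ℝ] ℝ)
    (b : E [⋀^Fin m]→L[ℝ] ℝ) (C : E →L[ℝ] E [⋀^Fin (j + m)]→L[ℝ] ℝ)
    (hC : ∀ w, C w = wedge (B w) b) (v : Fin (j + 1 + m) → E) :
    ContinuousAlternatingMap.alternatizeUncurryFin C
        (v ∘ Fin.cast (show j + m + 1 = j + 1 + m by omega)) =
      wedge (ContinuousAlternatingMap.alternatizeUncurryFin B) b v := by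
  rw [altUncurry_eq_altSum, wedge_eq_altSum]
  have h1 : (fun w : Fin (j + m + 1) → E => C (w 0) (w ∘ Fin.succ)) = fun w =>
      ((j ! * m ! : ℕ) : ℝ)⁻¹ * altSum ((fun x u => B x (u ∘ Fin.castAdd m) * b (u ∘ Fin.natAdd j))
        (w 0)) (w ∘ Fin.succ) := by
    ext w; rw [hC, wedge_eq_altSum]
  have h2 : (fun w : Fin (j + 1 + m) → E => ContinuousAlternatingMap.alternatizeUncurryFin B
      (w ∘ Fin.castAdd m) * b (w ∘ Fin.natAdd (j + 1))) = fun w => ((j ! : ℕ) : ℝ)⁻¹ *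
      (altSum (fun u => B (u 0) (u ∘ Fin.succ)) (w ∘ Fin.castAdd m) *
        b (w ∘ Fin.natAdd (j + 1))) := by
    ext w; rw [altUncurry_eq_altSum]; ring
  rw [h1, h2, altSum_const_mul, altSum_const_mul,
    altSum_inner_tail (fun x u => B x (u ∘ Fin.castAdd m) * b (u ∘ Fin.natAdd j)),
    altSum_inner_front (fun u : Fin (j + 1) → E => B (u 0) (u ∘ Fin.succ)) (fun u => b u),
    altSum_cast]
  have h3 : (fun w : Fin (j + 1 + m) → E =>
      B ((w ∘ Fin.cast (show j + m + 1 = j + 1 + m by omega)) 0)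
      (((w ∘ Fin.cast (show j + m + 1 = j + 1 + m by omega)) ∘ Fin.succ) ∘ Fin.castAdd m) *
      b (((w ∘ Fin.cast (show j + m + 1 = j + 1 + m by omega)) ∘ Fin.succ) ∘ Fin.natAdd j)) =
      fun w => B ((w ∘ Fin.castAdd m) 0) ((w ∘ Fin.castAdd m) ∘ Fin.succ) *
        b (w ∘ Fin.natAdd (j + 1)) := by
    ext w
    congr 2
    ext t
    simp only [Function.comp_apply]
    congr 1
    ext; simp; omega
  rw [h3]
  have e1 : ((j ! : ℕ) : ℝ) ≠ 0 := by positivity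
  have e2 : ((m ! : ℕ) : ℝ) ≠ 0 := by positivity
  have e3 : (((j + m) ! : ℕ) : ℝ) ≠ 0 := by positivity
  have e4 : (((j + 1) ! : ℕ) : ℝ) ≠ 0 := by positivity
  push_cast
  field_simp

theorem altUncurry_wedge_right {j m : ℕ} (a : E [⋀^Fin j]→L[ℝ] ℝ)
    (B : E →L[ℝ] E [⋀^Fin m]→L[ℝ] ℝ) (C : E →L[ℝ] E [⋀^Fin (j + m)]→L[ℝ] ℝ)
    (hC : ∀ w, C w = wedge a (B w)) (v : Fin (j + (m + 1)) → E) :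
    ContinuousAlternatingMap.alternatizeUncurryFin C v =
      (-1) ^ j * wedge a (ContinuousAlternatingMap.alternatizeUncurryFin B) v := by
  rw [altUncurry_eq_altSum, wedge_eq_altSum]
  have h1 : (fun w : Fin (j + m + 1) → E => C (w 0) (w ∘ Fin.succ)) = fun w =>
      ((j ! * m ! : ℕ) : ℝ)⁻¹ * altSum ((fun x u => a (u ∘ Fin.castAdd m) * B x (u ∘ Fin.natAdd j))
        (w 0)) (w ∘ Fin.succ) := by
    ext w; rw [hC, wedge_eq_altSum]
  have h2 : (fun w : Fin (j + (m + 1)) → E => a (w ∘ Fin.castAdd (m + 1)) *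
      ContinuousAlternatingMap.alternatizeUncurryFin B (w ∘ Fin.natAdd j)) =
      fun w => ((m ! : ℕ) : ℝ)⁻¹ * (a (w ∘ Fin.castAdd (m + 1)) *
      (altSum (fun u => B (u 0) (u ∘ Fin.succ)) (w ∘ Fin.natAdd j))) := by
    ext w; rw [altUncurry_eq_altSum]; ring
  rw [h1, h2, altSum_const_mul, altSum_const_mul,
    altSum_inner_tail (fun x u => a (u ∘ Fin.castAdd m) * B x (u ∘ Fin.natAdd j)),
    altSum_inner_back (fun u => a u) (fun u : Fin (m + 1) → E => B (u 0) (u ∘ Fin.succ))]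
  obtain ⟨τ, hs, h0, hτ⟩ := exists_perm_front (n := j + m) ⟨j, by omega⟩
  have h3 : (fun w : Fin (j + m + 1) → E => a ((w ∘ Fin.castAdd (m + 1))) *
      B ((w ∘ Fin.natAdd j) (0 : Fin (m + 1))) ((w ∘ Fin.natAdd j) ∘ (Fin.succ : Fin m → _))) =
      fun w => (fun w => a ((w ∘ Fin.succ) ∘ Fin.castAdd m) *
        B (w 0) ((w ∘ Fin.succ) ∘ Fin.natAdd j)) (w ∘ τ) := by
    ext w
    simp only [Function.comp_apply, h0]
    congr 1
    · congr 1
      ext t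
      simp only [Function.comp_apply, hτ]
      congr 1
      ext
      simp [Fin.succAbove, Fin.lt_def]
    · congr 1
      ext t
      simp only [Function.comp_apply, hτ]
      congr 1
      ext
      simp [Fin.succAbove, Fin.lt_def]
      omega
  have h4 := altSum_perm (fun w : Fin (j + m + 1) → E => a ((w ∘ Fin.succ) ∘ Fin.castAdd m) *
        B (w 0) ((w ∘ Fin.succ) ∘ Fin.natAdd j)) τ v
  rw [← h3, hs] at h4
  have h5 : altSum (fun w : Fin (j + (m + 1)) → E => a (w ∘ Fin.castAdd (m + 1)) *
      B ((w ∘ Fin.natAdd j) 0) ((w ∘ Fin.natAdd j) ∘ Fin.succ)) v = _ := h4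
  rw [h5]
  have e1 : ((j ! : ℕ) : ℝ) ≠ 0 := by positivity
  have e2 : ((m ! : ℕ) : ℝ) ≠ 0 := by positivity
  have e3 : (((j + m) ! : ℕ) : ℝ) ≠ 0 := by positivity
  have e4 : (((m + 1) ! : ℕ) : ℝ) ≠ 0 := by positivity
  have e5 := neg_one_pow_mul_self' j
  push_cast
  field_simp
  rw [pow_two, e5, mul_one]

end Algebra

end Prelim

section NormedWedge
variable {E : Type*} [NormedAddCommGroup E] [NormedSpace ℝ E]

theorem wedge_add_left {j m : ℕ} (a a' : E [⋀^Fin j]→L[ℝ] ℝ) (b : E [⋀^Fin m]→L[ℝ] ℝ) :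
    wedge (a + a') b = wedge a b + wedge a' b := by
  ext v
  simp only [wedge_apply, ContinuousAlternatingMap.add_apply, ← mul_add, ← Finset.sum_add_distrib]
  exact congrArg _ (Finset.sum_congr rfl fun σ _ => by ring)

theorem wedge_add_right {j m : ℕ} (a : E [⋀^Fin j]→L[ℝ] ℝ) (b b' : E [⋀^Fin m]→L[ℝ] ℝ) :
    wedge a (b + b') = wedge a b + wedge a b' := by
  ext v
  simp only [wedge_apply, ContinuousAlternatingMap.add_apply, ← mul_add, ← Finset.sum_add_distrib]

theorem wedge_smul_left {j m : ℕ} (c : ℝ) (a : E [⋀^Fin j]→L[ℝ] ℝ) (b : E [⋀^Fin m]→L[ℝ] ℝ) :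
    wedge (c • a) b = c • wedge a b := by
  ext v
  simp only [wedge_apply, ContinuousAlternatingMap.smul_apply, smul_eq_mul, Finset.mul_sum]
  exact Finset.sum_congr rfl fun σ _ => by ring

theorem wedge_smul_right {j m : ℕ} (c : ℝ) (a : E [⋀^Fin j]→L[ℝ] ℝ) (b : E [⋀^Fin m]→L[ℝ] ℝ) :
    wedge a (c • b) = c • wedge a b := by
  ext v
  simp only [wedge_apply, ContinuousAlternatingMap.smul_apply, smul_eq_mul, Finset.mul_sum]
  exact Finset.sum_congr rfl fun σ _ => by ring

/-- The wedge product as a continuous bilinear map. -/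
noncomputable def wedgeCLM (E : Type*) [NormedAddCommGroup E] [NormedSpace ℝ E]
    [FiniteDimensional ℝ E] (j m : ℕ) :
    (E [⋀^Fin j]→L[ℝ] ℝ) →L[ℝ] (E [⋀^Fin m]→L[ℝ] ℝ) →L[ℝ] (E [⋀^Fin (j + m)]→L[ℝ] ℝ) :=
  haveI := finiteDimensional_alt (E := E) j
  haveI := finiteDimensional_alt (E := E) m
  LinearMap.toContinuousBilinearMap
    (LinearMap.mk₂ ℝ (wedge (E := E) (j := j) (m := m)) wedge_add_left wedge_smul_left
      wedge_add_right wedge_smul_right)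

theorem wedgeCLM_apply [FiniteDimensional ℝ E] {j m : ℕ} (a : E [⋀^Fin j]→L[ℝ] ℝ)
    (b : E [⋀^Fin m]→L[ℝ] ℝ) : wedgeCLM E j m a b = wedge a b := rfl

/-- The graded Leibniz rule on a normed space. -/
theorem extDeriv_wedge [FiniteDimensional ℝ E] {j m : ℕ} {a : E → E [⋀^Fin j]→L[ℝ] ℝ}
    {b : E → E [⋀^Fin m]→L[ℝ] ℝ} {x : E} (ha : DifferentiableAt ℝ a x)
    (hb : DifferentiableAt ℝ b x) (v : Fin (j + m + 1) → E) :
    extDeriv (fun y => wedge (a y) (b y)) x v =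
      wedge (extDeriv a x) (b x) (v ∘ Fin.cast (show j + 1 + m = j + m + 1 by omega)) +
        (-1) ^ j * wedge (a x) (extDeriv b x) v := by
  have h := (wedgeCLM E j m).hasFDerivAt_of_bilinear ha.hasFDerivAt hb.hasFDerivAt
  have h' : fderiv ℝ (fun y => wedge (a y) (b y)) x = _ := h.fderiv
  rw [extDeriv, h', ContinuousAlternatingMap.alternatizeUncurryFin_add,
    ContinuousAlternatingMap.add_apply, add_comm]
  congr 1
  · rw [extDeriv, ← altUncurry_wedge_left (fderiv ℝ a x) (b x)
      ((wedgeCLM E j m).precompL E (fderiv ℝ a x) (b x)) (fun w => by simp [wedgeCLM_apply])]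
    rfl
  · exact altUncurry_wedge_right (a x) (fderiv ℝ b x)
      ((wedgeCLM E j m).precompR E (a x) (fderiv ℝ b x)) (fun w => by simp [wedgeCLM_apply]) v

end NormedWedge

section Forms

variable (E : Type*) [NormedAddCommGroup E] [NormedSpace ℝ E]
  {X : Type*} [TopologicalSpace X] [ChartedSpace E X]

/-- A family of alternating `q`-forms on all tangent spaces of `X`, without regularity. -/
abbrev RawForm (X : Type*) [TopologicalSpace X] [ChartedSpace E X] (q : ℕ) :=
  ∀ x : X, TangentSpace 𝓘(ℝ, E) x [⋀^Fin q]→L[ℝ] ℝ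

variable {E}

/-- The expression of a form in a chart `φ`, the pullback along `φ.symm`. -/
noncomputable def localRep {q : ℕ} (φ : OpenPartialHomeomorph X E) (w : RawForm E X q) :
    E → E [⋀^Fin q]→L[ℝ] ℝ := fun y =>
  (w (φ.symm y)).compContinuousLinearMap (mfderiv 𝓘(ℝ, E) 𝓘(ℝ, E) φ.symm y)

/-- The part of the domain of `φ.symm` that corresponds to `V`. -/
def chartDom (φ : OpenPartialHomeomorph X E) (V : Opens X) : Set E :=
  φ.target ∩ φ.symm ⁻¹' V

theorem isOpen_chartDom (φ : OpenPartialHomeomorph X E) (V : Opens X) : IsOpen (chartDom φ V) :=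
  φ.isOpen_inter_preimage_symm V.isOpen

theorem localRep_add {q : ℕ} (φ : OpenPartialHomeomorph X E) (w w' : RawForm E X q) :
    localRep φ (w + w') = localRep φ w + localRep φ w' := rfl

theorem localRep_neg {q : ℕ} (φ : OpenPartialHomeomorph X E) (w : RawForm E X q) :
    localRep φ (-w) = -localRep φ w := rfl

theorem localRep_congr {q : ℕ} {φ : OpenPartialHomeomorph X E} {w w' : RawForm E X q}
    {V : Opens X} (h : ∀ x ∈ V, w x = w' x) : Set.EqOn (localRep φ w) (localRep φ w') (chartDom φ V) :=
  fun y hy => by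
    have : w (φ.symm y) = w' (φ.symm y) := h _ hy.2
    simp only [localRep, this]

variable (E) in
/-- The group of smooth differential `q`-forms on the open set `V`. A form on `V` is encoded by its
extension by zero to a family on all of `X`. -/
def DForm (V : Opens X) (q : ℕ) : AddSubgroup (RawForm E X q) where
  carrier := {w | (∀ x ∉ V, w x = 0) ∧
    ∀ φ ∈ atlas E X, ContDiffOn ℝ ∞ (localRep φ w) (φ.target ∩ φ.symm ⁻¹' V)}
  zero_mem' := ⟨fun _ _ => rfl, fun _ _ => contDiffOn_const (c := 0)⟩
  add_mem' := fun ha hb => ⟨fun x hx => by rw [Pi.add_apply, ha.1 x hx, hb.1 x hx, add_zero],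
    fun φ hφ => (ha.2 φ hφ).add (hb.2 φ hφ)⟩
  neg_mem' := fun ha => ⟨fun x hx => by rw [Pi.neg_apply, ha.1 x hx, neg_zero],
    fun φ hφ => (ha.2 φ hφ).neg⟩

end Forms

section Forms

variable {E : Type*} [NormedAddCommGroup E] [NormedSpace ℝ E]
  {X : Type*} [TopologicalSpace X] [ChartedSpace E X]

theorem mdiff_chart [IsManifold 𝓘(ℝ, E) ∞ X] {φ : OpenPartialHomeomorph X E} (hφ : φ ∈ atlas E X)
    {x : X} (hx : x ∈ φ.source) : MDifferentiableAt 𝓘(ℝ, E) 𝓘(ℝ, E) φ x :=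
  haveI : IsManifold 𝓘(ℝ, E) 1 X := IsManifold.of_le (n := ∞) (by simp)
  mdifferentiableAt_atlas hφ hx

theorem mdiff_chart_symm [IsManifold 𝓘(ℝ, E) ∞ X] {φ : OpenPartialHomeomorph X E}
    (hφ : φ ∈ atlas E X) {y : E} (hy : y ∈ φ.target) :
    MDifferentiableAt 𝓘(ℝ, E) 𝓘(ℝ, E) φ.symm y :=
  haveI : IsManifold 𝓘(ℝ, E) 1 X := IsManifold.of_le (n := ∞) (by simp)
  mdifferentiableAt_atlas_symm hφ hy

/-- A form is recovered from its expression in a chart. -/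
theorem localRep_comp [IsManifold 𝓘(ℝ, E) ∞ X] {q : ℕ} {φ : OpenPartialHomeomorph X E}
    (hφ : φ ∈ atlas E X) (w : RawForm E X q) {x : X} (hx : x ∈ φ.source) :
    (localRep φ w (φ x)).compContinuousLinearMap (mfderiv 𝓘(ℝ, E) 𝓘(ℝ, E) φ x) = w x := by
  have h1 := mfderiv_comp x (mdiff_chart_symm hφ (φ.map_source hx)) (mdiff_chart hφ hx)
  have h2 : mfderiv 𝓘(ℝ, E) 𝓘(ℝ, E) (φ.symm ∘ φ) x = ContinuousLinearMap.id ℝ _ := by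
    have : (φ.symm ∘ φ) =ᶠ[𝓝 x] id := φ.eventually_left_inverse hx
    rw [this.mfderiv_eq, mfderiv_id]
  rw [h2] at h1
  have h3 : ∀ u : E, (mfderiv 𝓘(ℝ, E) 𝓘(ℝ, E) φ.symm (φ x) : E → E)
      ((mfderiv 𝓘(ℝ, E) 𝓘(ℝ, E) φ x : E → E) u) = u := fun u =>
    (congrArg (fun L : E →L[ℝ] E => L u) h1).symm
  ext v
  have h4 : (w (φ.symm (φ x)) : (Fin q → E) → ℝ) (fun i => (mfderiv 𝓘(ℝ, E) 𝓘(ℝ, E) φ.symm (φ x) : E → E)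
      ((mfderiv 𝓘(ℝ, E) 𝓘(ℝ, E) φ x : E → E) (v i))) = (w x : (Fin q → E) → ℝ) v := by
    rw [show (fun i => (mfderiv 𝓘(ℝ, E) 𝓘(ℝ, E) φ.symm (φ x) : E → E)
      ((mfderiv 𝓘(ℝ, E) 𝓘(ℝ, E) φ x : E → E) (v i))) = v from funext fun i => h3 (v i)]
    have h5 : ∀ x', x' = x → (w x' : (Fin q → E) → ℝ) v = (w x : (Fin q → E) → ℝ) v := by
      rintro _ rfl; rfl
    exact h5 _ (φ.left_inv hx)
  exact h4

/-- Change of chart for the expression of a form. -/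
theorem localRep_change [IsManifold 𝓘(ℝ, E) ∞ X] {q : ℕ} {φ ψ : OpenPartialHomeomorph X E}
    (hφ : φ ∈ atlas E X) (hψ : ψ ∈ atlas E X) (w : RawForm E X q) {y : E}
    (hy : y ∈ ψ.target) (hy' : ψ.symm y ∈ φ.source) :
    localRep ψ w y = (localRep φ w (φ (ψ.symm y))).compContinuousLinearMap
      (fderiv ℝ (φ ∘ ψ.symm) y) := by
  have h1 := mfderiv_comp y (mdiff_chart hφ hy') (mdiff_chart_symm hψ hy)
  rw [mfderiv_eq_fderiv] at h1
  rw [h1]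
  have h2 := localRep_comp hφ w hy'
  unfold localRep at h2 ⊢
  rw [← h2]
  rfl

/-- The exterior derivative of a family of forms at a point, computed in the preferred chart. -/
noncomputable def rawD {q : ℕ} (w : RawForm E X q) : RawForm E X (q + 1) := fun x =>
  (extDeriv (localRep (chartAt E x) w) (chartAt E x x)).compContinuousLinearMap
    (mfderiv 𝓘(ℝ, E) 𝓘(ℝ, E) (chartAt E x) x)

theorem diffAt_localRep {V : Opens X} {q : ℕ} (w : DForm E V q) {φ : OpenPartialHomeomorph X E}
    (hφ : φ ∈ atlas E X) {y : E} (hy : y ∈ chartDom φ V) :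
    ContDiffAt ℝ ∞ (localRep φ w.1) y :=
  (w.2.2 φ hφ).contDiffAt ((isOpen_chartDom φ V).mem_nhds hy)

/-- The exterior derivative is computed by `extDeriv` in every chart. -/
theorem localRep_rawD [IsManifold 𝓘(ℝ, E) ∞ X] {V : Opens X} {q : ℕ} (w : DForm E V q)
    {ψ : OpenPartialHomeomorph X E} (hψ : ψ ∈ atlas E X) {y : E} (hy : y ∈ chartDom ψ V) :
    localRep ψ (rawD w.1) y = extDeriv (localRep ψ w.1) y := by
  set φ := chartAt E (ψ.symm y) with hφd
  have hφ : φ ∈ atlas E X := chart_mem_atlas E _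
  have hs : ψ.symm y ∈ φ.source := mem_chart_source E _
  have hτ : ContDiffAt ℝ ∞ (φ ∘ ψ.symm) y := by
    have h := (contDiffGroupoid ∞ 𝓘(ℝ, E)).compatible hψ hφ
    have h2 := (contDiffGroupoid ∞ 𝓘(ℝ, E)).mem_iff_of_eqOnSource (Setoid.refl _) |>.1 h
    have h3 := (mem_groupoid_of_pregroupoid.1 h2).1
    have h4 : ContDiffOn ℝ ∞ (φ ∘ ψ.symm) (ψ.symm.trans φ).source := by
      simpa [contDiffPregroupoid] using h3
    refine h4.contDiffAt ((ψ.symm.trans φ).open_source.mem_nhds ?_)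
    simp [hy.1, hs]
  have hev : localRep ψ w.1 =ᶠ[𝓝 y] fun z => (localRep φ w.1 ((φ ∘ ψ.symm) z)).compContinuousLinearMap
      (fderiv ℝ (φ ∘ ψ.symm) z) := by
    have : ψ.target ∩ ψ.symm ⁻¹' φ.source ∈ 𝓝 y :=
      (ψ.isOpen_inter_preimage_symm φ.open_source).mem_nhds ⟨hy.1, hs⟩
    filter_upwards [this] with z hz
    exact localRep_change hφ hψ w.1 hz.1 hz.2
  rw [hev.extDeriv_eq, extDeriv_pullback (r := ∞) _ hτ
    (by rw [minSmoothness_of_isRCLikeNormedField]; exact WithTop.coe_le_coe.2 (le_top (a := (2 : ℕ∞))))]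
  · have h1 := mfderiv_comp y (mdiff_chart hφ hs) (mdiff_chart_symm hψ hy.1)
    rw [mfderiv_eq_fderiv] at h1
    rw [h1]
    rfl
  · refine (diffAt_localRep w hφ ⟨φ.map_source hs, ?_⟩).differentiableAt (by simp)
    change φ.symm (φ (ψ.symm y)) ∈ V
    rw [φ.left_inv hs]
    exact hy.2

theorem contDiffOn_extDeriv {q : ℕ} {f : E → E [⋀^Fin q]→L[ℝ] ℝ} {s : Set E} (hs : IsOpen s)
    (hf : ContDiffOn ℝ ∞ f s) : ContDiffOn ℝ ∞ (extDeriv f) s := by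
  have h := hf.fderiv_of_isOpen (m := ∞) hs (by simp)
  exact (ContinuousAlternatingMap.alternatizeUncurryFinCLM ℝ E ℝ).contDiff.comp_contDiffOn h

open Classical in
/-- Extension by zero of the restriction of a family to the open set `V`. -/
noncomputable def cutoff {q : ℕ} (V : Opens X) (w : RawForm E X q) : RawForm E X q := fun x =>
  if x ∈ V then w x else 0

theorem cutoff_of_mem {q : ℕ} {V : Opens X} (w : RawForm E X q) {x : X} (hx : x ∈ V) :
    cutoff V w x = w x := if_pos hx

theorem cutoff_of_notMem {q : ℕ} {V : Opens X} (w : RawForm E X q) {x : X} (hx : x ∉ V) :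
    cutoff V w x = 0 := if_neg hx

theorem cutoff_mem {q : ℕ} {V : Opens X} {w : RawForm E X q}
    (h : ∀ φ ∈ atlas E X, ContDiffOn ℝ ∞ (localRep φ w) (chartDom φ V)) :
    cutoff V w ∈ DForm E V q :=
  ⟨fun _ hx => cutoff_of_notMem w hx, fun φ hφ => (h φ hφ).congr
    (localRep_congr fun _ hx => cutoff_of_mem w hx)⟩

theorem DForm.ext' {V : Opens X} {q : ℕ} {w w' : DForm E V q} (h : ∀ x ∈ V, w.1 x = w'.1 x) :
    w = w' := by
  apply Subtype.ext
  funext x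
  by_cases hx : x ∈ V
  · exact h x hx
  · rw [w.2.1 x hx, w'.2.1 x hx]

/-- The exterior derivative of forms on an open set. -/
noncomputable def extD [IsManifold 𝓘(ℝ, E) ∞ X] {V : Opens X} {q : ℕ} :
    DForm E V q →+ DForm E V (q + 1) where
  toFun w := ⟨cutoff V (rawD w.1), cutoff_mem fun φ hφ =>
    (contDiffOn_extDeriv (isOpen_chartDom φ V) (w.2.2 φ hφ)).congr fun _ hy =>
      localRep_rawD w hφ hy⟩
  map_zero' := by
    apply DForm.ext'
    intro x hx
    refine (cutoff_of_mem _ hx).trans ?_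
    have : localRep (chartAt E x) ((0 : DForm E V q) : RawForm E X q) = 0 := rfl
    have h2 : extDeriv (0 : E → E [⋀^Fin q]→L[ℝ] ℝ) (chartAt E x x) = 0 := by
      have h0 := extDeriv_smul (0 : ℝ) (0 : E → E [⋀^Fin q]→L[ℝ] ℝ) (x := chartAt E x x)
      simpa using h0
    simp only [rawD, this, h2]
    rfl
  map_add' w w' := by
    apply DForm.ext'
    intro x hx
    have hd : chartAt E x x ∈ chartDom (chartAt E x) V := by
      refine ⟨mem_chart_target E x, ?_⟩
      change (chartAt E x).symm (chartAt E x x) ∈ V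
      rwa [(chartAt E x).left_inv (mem_chart_source E x)]
    have h := extDeriv_add
      ((diffAt_localRep w (chart_mem_atlas E x) hd).differentiableAt (by simp))
      ((diffAt_localRep w' (chart_mem_atlas E x) hd).differentiableAt (by simp))
    refine (cutoff_of_mem _ hx).trans (Eq.trans ?_
      (congrArg₂ (· + ·) (cutoff_of_mem _ hx) (cutoff_of_mem _ hx)).symm)
    have h2 : localRep (chartAt E x) ((w + w' : DForm E V q) : RawForm E X q) =
      localRep (chartAt E x) w.1 + localRep (chartAt E x) w'.1 := rfl
    simp only [rawD, h2, h]
    rfl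

theorem chartAt_mem_chartDom {V : Opens X} {x : X} (hx : x ∈ V) :
    chartAt E x x ∈ chartDom (chartAt E x) V := by
  refine ⟨mem_chart_target E x, ?_⟩
  change (chartAt E x).symm (chartAt E x x) ∈ V
  rwa [(chartAt E x).left_inv (mem_chart_source E x)]

/-- Restriction of forms to a smaller open set. -/
noncomputable def res {V W : Opens X} (h : W ≤ V) {q : ℕ} : DForm E V q →+ DForm E W q where
  toFun w := ⟨cutoff W w.1, cutoff_mem fun φ hφ =>
    (w.2.2 φ hφ).mono fun _ hy => ⟨hy.1, h hy.2⟩⟩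
  map_zero' := DForm.ext' fun _ hx => cutoff_of_mem _ hx
  map_add' w w' := DForm.ext' fun _ hx => (cutoff_of_mem _ hx).trans
    (congrArg₂ (· + ·) (cutoff_of_mem w.1 hx) (cutoff_of_mem w'.1 hx)).symm

/-- The pointwise wedge product. -/
noncomputable def rawWedge {j m : ℕ} (w : RawForm E X j) (w' : RawForm E X m) :
    RawForm E X (j + m) := fun x => wedge (w x) (w' x)

theorem localRep_wedge {j m : ℕ} (φ : OpenPartialHomeomorph X E) (w : RawForm E X j)
    (w' : RawForm E X m) (y : E) :
    localRep φ (rawWedge w w') y = wedge (localRep φ w y) (localRep φ w' y) := by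
  ext v
  unfold localRep
  rw [wedge_apply]
  exact wedge_apply _ _ _

/-- The wedge product of two forms on an open set. -/
noncomputable def wedgeFn [FiniteDimensional ℝ E] {V : Opens X} {j m : ℕ} (w : DForm E V j)
    (w' : DForm E V m) : DForm E V (j + m) :=
  ⟨cutoff V (rawWedge w.1 w'.1), cutoff_mem fun φ hφ => by
    have h := ((wedgeCLM E j m).isBoundedBilinearMap.contDiff (n := ∞)).comp_contDiffOn
      ((w.2.2 φ hφ).prodMk (w'.2.2 φ hφ))
    exact h.congr fun y _ => localRep_wedge φ _ _ y⟩

theorem wedgeFn_apply [FiniteDimensional ℝ E] {V : Opens X} {j m : ℕ} (w : DForm E V j)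
    (w' : DForm E V m) {x : X} (hx : x ∈ V) :
    (wedgeFn w w').1 x = rawWedge w.1 w'.1 x := cutoff_of_mem _ hx

/-- The wedge product of forms on an open set, as a biadditive map. -/
noncomputable def wedgeForm [FiniteDimensional ℝ E] {V : Opens X} {j m : ℕ} :
    DForm E V j →+ DForm E V m →+ DForm E V (j + m) :=
  AddMonoidHom.mk' (fun w => AddMonoidHom.mk' (fun w' => wedgeFn w w')
    fun _ _ => DForm.ext' fun _ hx => (wedgeFn_apply _ _ hx).trans (Eq.trans
      (wedge_add_right (E := E) _ _ _)
      (congrArg₂ (· + ·) (wedgeFn_apply _ _ hx) (wedgeFn_apply _ _ hx)).symm))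
    fun _ _ => AddMonoidHom.ext fun _ => DForm.ext' fun _ hx => (wedgeFn_apply _ _ hx).trans
      (Eq.trans (wedge_add_left (E := E) _ _ _)
      (congrArg₂ (· + ·) (wedgeFn_apply _ _ hx) (wedgeFn_apply _ _ hx)).symm)

end Forms

section Combinatorics
variable {ι : Type*}

/-- The first `r + 1` entries of a tuple. -/
def front (r s : ℕ) (t : Fin (r + 1)) : Fin (r + s + 1) := ⟨t, by omega⟩

/-- The last `s + 1` entries of a tuple. -/
def back (r s : ℕ) (t : Fin (s + 1)) : Fin (r + s + 1) := ⟨r + t, by omega⟩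

theorem sum_delta_delta {n : ℕ} (F : (Fin (n + 1) → ι) → ℝ) (i : Fin (n + 3) → ι) :
    ∑ t : Fin (n + 3), (-1 : ℝ) ^ (t : ℕ) * ∑ u : Fin (n + 2), (-1 : ℝ) ^ (u : ℕ) *
      F ((i ∘ t.succAbove) ∘ u.succAbove) = 0 := by
  simp only [Finset.mul_sum]
  rw [← Fintype.sum_prod_type' (f := fun (t : Fin (n + 3)) (u : Fin (n + 2)) =>
    (-1 : ℝ) ^ (t : ℕ) * ((-1 : ℝ) ^ (u : ℕ) * F ((i ∘ t.succAbove) ∘ u.succAbove)))]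
  refine Finset.sum_involution (fun p _ => (p.1.succAbove p.2, p.2.predAbove p.1)) ?_ ?_ ?_ ?_
  · rintro ⟨t, u⟩ -
    have h1 : (i ∘ (t.succAbove u).succAbove) ∘ (u.predAbove t).succAbove =
        (i ∘ t.succAbove) ∘ u.succAbove := by
      ext k
      simp [Fin.succAbove_succAbove_succAbove_predAbove]
    have h2 := Fin.neg_one_pow_succAbove_add_predAbove (R := ℝ) t u
    dsimp only
    rw [h1, ← mul_assoc, ← mul_assoc, ← pow_add, ← pow_add, h2]
    ring
  · rintro ⟨t, u⟩ - -
    intro h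
    exact Fin.succAbove_ne t u (congrArg Prod.fst h)
  · intro _ _; exact Finset.mem_univ _
  · rintro ⟨t, u⟩ -
    ext1
    · exact Fin.succAbove_succAbove_predAbove t u
    · exact Fin.predAbove_predAbove_succAbove t u

theorem sum_delta_leibniz {r s : ℕ} (G : (Fin (r + 1) → ι) → (Fin (s + 1) → ι) → ℝ)
    (i : Fin (r + s + 1 + 1) → ι) :
    ∑ t : Fin (r + s + 1 + 1), (-1 : ℝ) ^ (t : ℕ) *
        G ((i ∘ t.succAbove) ∘ front r s) ((i ∘ t.succAbove) ∘ back r s) =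
      ∑ t : Fin (r + 1 + 1), (-1 : ℝ) ^ (t : ℕ) *
        G (((i ∘ Fin.cast (by omega)) ∘ front (r + 1) s) ∘ t.succAbove)
          ((i ∘ Fin.cast (by omega)) ∘ back (r + 1) s) +
      (-1) ^ r * ∑ u : Fin (s + 1 + 1), (-1 : ℝ) ^ (u : ℕ) *
        G ((i ∘ Fin.cast (by omega)) ∘ front r (s + 1))
          (((i ∘ Fin.cast (by omega)) ∘ back r (s + 1)) ∘ u.succAbove) := by
  rw [Fin.sum_univ_castSucc (n := r + 1), Fin.sum_univ_succ (n := s + 1)]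
  rw [← Fintype.sum_equiv (finCongr (show (r + 1) + (s + 1) = r + s + 1 + 1 by omega)) _ _
    (fun _ => rfl), Fin.sum_univ_add]
  have key : ∀ (a b : Fin (r + 1) → ι) (c d : Fin (s + 1) → ι), a = b → c = d → G a c = G b d := by
    rintro a _ c _ rfl rfl; rfl
  have h1 : ∀ t : Fin (r + 1), G
      ((i ∘ (finCongr (show (r + 1) + (s + 1) = r + s + 1 + 1 by omega)
        (Fin.castAdd (s + 1) t)).succAbove) ∘ front r s)
      ((i ∘ (finCongr (show (r + 1) + (s + 1) = r + s + 1 + 1 by omega)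
        (Fin.castAdd (s + 1) t)).succAbove) ∘ back r s) =
      G (((i ∘ Fin.cast (by omega)) ∘ front (r + 1) s) ∘ t.castSucc.succAbove)
          ((i ∘ Fin.cast (by omega)) ∘ back (r + 1) s) := fun t => by
    refine key _ _ _ _ ?_ ?_ <;> ext k <;> simp only [Function.comp_apply] <;> congr 1 <;> ext <;>
      simp only [front, back, Fin.succAbove, Fin.lt_def, apply_ite Fin.val, Fin.val_cast,
        Function.comp_apply, Fin.val_castSucc, Fin.val_succ, finCongr_apply, Fin.val_castAdd,
        Fin.val_natAdd] <;> split_ifs <;> omega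
  have h2 : ∀ u : Fin (s + 1), G
      ((i ∘ (finCongr (show (r + 1) + (s + 1) = r + s + 1 + 1 by omega)
        (Fin.natAdd (r + 1) u)).succAbove) ∘ front r s)
      ((i ∘ (finCongr (show (r + 1) + (s + 1) = r + s + 1 + 1 by omega)
        (Fin.natAdd (r + 1) u)).succAbove) ∘ back r s) =
      G ((i ∘ Fin.cast (by omega)) ∘ front r (s + 1))
          (((i ∘ Fin.cast (by omega)) ∘ back r (s + 1)) ∘ u.succ.succAbove) := fun t => by
    refine key _ _ _ _ ?_ ?_ <;> ext k <;> simp only [Function.comp_apply] <;> congr 1 <;> ext <;>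
      simp only [front, back, Fin.succAbove, Fin.lt_def, apply_ite Fin.val, Fin.val_cast,
        Function.comp_apply, Fin.val_castSucc, Fin.val_succ, finCongr_apply, Fin.val_castAdd,
        Fin.val_natAdd] <;> split_ifs <;> omega
  have h3 : G (((i ∘ Fin.cast (by omega)) ∘ front (r + 1) s) ∘ (Fin.last (r + 1)).succAbove)
          ((i ∘ Fin.cast (by omega)) ∘ back (r + 1) s) =
      G ((i ∘ Fin.cast (by omega)) ∘ front r (s + 1))
          (((i ∘ Fin.cast (by omega)) ∘ back r (s + 1)) ∘ (0 : Fin (s + 1 + 1)).succAbove) := by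
    refine key _ _ _ _ ?_ ?_ <;> ext k <;> simp only [Function.comp_apply] <;> congr 1 <;> ext <;>
      simp [front, back] <;> omega
  simp only [h1, h2, h3]
  simp only [finCongr_apply, Fin.val_cast, Fin.val_castAdd, Fin.val_natAdd, Fin.val_castSucc,
    Fin.val_last, Fin.val_succ, Fin.val_zero, pow_zero, one_mul, mul_add, Finset.mul_sum]
  have h4 : ∀ u : Fin (s + 1), ∀ z : ℝ, (-1 : ℝ) ^ (r + 1 + (u : ℕ)) * z =
      (-1) ^ r * ((-1) ^ ((u : ℕ) + 1) * z) := fun u z => by ring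
  simp only [h4]
  ring

end Combinatorics

section Forms

variable {E : Type*} [NormedAddCommGroup E] [NormedSpace ℝ E]
  {X : Type*} [TopologicalSpace X] [ChartedSpace E X]

theorem res_apply {V W : Opens X} (h : W ≤ V) {q : ℕ} (w : DForm E V q) {x : X} (hx : x ∈ W) :
    (res h w).1 x = w.1 x := cutoff_of_mem _ hx

theorem wedgeForm_apply [FiniteDimensional ℝ E] {V : Opens X} {j m : ℕ} (w : DForm E V j)
    (w' : DForm E V m) {x : X} (hx : x ∈ V) :
    (wedgeForm w w').1 x = wedge (E := TangentSpace 𝓘(ℝ, E) x) (w.1 x) (w'.1 x) :=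
  cutoff_of_mem _ hx

variable [IsManifold 𝓘(ℝ, E) ∞ X]

theorem extD_apply {V : Opens X} {q : ℕ} (w : DForm E V q) {x : X} (hx : x ∈ V) :
    (extD w).1 x = rawD w.1 x := cutoff_of_mem _ hx

theorem rawD_congr {q : ℕ} {w w' : RawForm E X q} {V : Opens X} (h : ∀ x ∈ V, w x = w' x)
    {x : X} (hx : x ∈ V) : rawD w x = rawD w' x := by
  have : localRep (chartAt E x) w =ᶠ[𝓝 (chartAt E x x)] localRep (chartAt E x) w' :=
    (localRep_congr h).eventuallyEq_of_mem
      ((isOpen_chartDom (chartAt E x) V).mem_nhds (chartAt_mem_chartDom hx))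
  simp only [rawD, this.extDeriv_eq]

theorem extD_res {V W : Opens X} (h : W ≤ V) {q : ℕ} (w : DForm E V q) :
    extD (res h w) = res h (extD w) :=
  DForm.ext' fun x hx => by
    rw [extD_apply _ hx, res_apply h _ hx, extD_apply _ (h hx)]
    exact rawD_congr (fun y hy => res_apply h w hy) hx

theorem extD_extD {V : Opens X} {q : ℕ} (w : DForm E V q) : extD (extD w) = 0 :=
  DForm.ext' fun x hx => by
    rw [extD_apply _ hx]
    have h1 : localRep (chartAt E x) (extD w).1 =ᶠ[𝓝 (chartAt E x x)]
        extDeriv (localRep (chartAt E x) w.1) := by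
      refine Set.EqOn.eventuallyEq_of_mem (s := chartDom (chartAt E x) V) (fun y hy => ?_)
        ((isOpen_chartDom (chartAt E x) V).mem_nhds (chartAt_mem_chartDom hx))
      rw [← localRep_rawD w (chart_mem_atlas E x) hy]
      exact localRep_congr (fun z hz => extD_apply w hz) hy
    have h2 := extDeriv_extDeriv_apply
      (diffAt_localRep w (chart_mem_atlas E x) (chartAt_mem_chartDom hx))
      (by rw [minSmoothness_of_isRCLikeNormedField]
          exact WithTop.coe_le_coe.2 (le_top (a := (2 : ℕ∞))))
    simp only [rawD, h1.extDeriv_eq, h2]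
    rfl

theorem extD_wedge [FiniteDimensional ℝ E] {V : Opens X} {j m : ℕ} (w : DForm E V j)
    (w' : DForm E V m) {x : X} (hx : x ∈ V) (v : Fin (j + m + 1) → TangentSpace 𝓘(ℝ, E) x) :
    (extD (wedgeForm w w')).1 x v =
      (wedgeForm (extD w) w').1 x (v ∘ Fin.cast (show j + 1 + m = j + m + 1 by omega)) +
        (-1) ^ j * (wedgeForm w (extD w')).1 x v := by
  set φ := chartAt E x with hφ
  have hc := chartAt_mem_chartDom (E := E) hx
  have h1 : localRep φ (wedgeForm w w').1 =ᶠ[𝓝 (φ x)]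
      fun y => wedge (localRep φ w.1 y) (localRep φ w'.1 y) := by
    refine Set.EqOn.eventuallyEq_of_mem (s := chartDom φ V) (fun y hy => ?_)
      ((isOpen_chartDom φ V).mem_nhds hc)
    rw [← localRep_wedge]
    exact localRep_congr (fun z hz => wedgeFn_apply w w' hz) hy
  have h2 := extDeriv_wedge
    ((diffAt_localRep w (chart_mem_atlas E x) hc).differentiableAt (by simp))
    ((diffAt_localRep w' (chart_mem_atlas E x) hc).differentiableAt (by simp))
    (fun t => (mfderiv 𝓘(ℝ, E) 𝓘(ℝ, E) φ x : E → E) (v t))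
  rw [extD_apply _ hx, wedgeForm_apply _ _ hx, wedgeForm_apply _ _ hx, extD_apply _ hx,
    extD_apply _ hx]
  have h3 : rawD (wedgeForm w w').1 x v = extDeriv (localRep φ (wedgeForm w w').1) (φ x)
    (fun t => (mfderiv 𝓘(ℝ, E) 𝓘(ℝ, E) φ x : E → E) (v t)) := rfl
  rw [h3, h1.extDeriv_eq]
  refine h2.trans ?_
  have e1 := localRep_comp (chart_mem_atlas E x) w.1 (mem_chart_source E x)
  have e2 := localRep_comp (chart_mem_atlas E x) w'.1 (mem_chart_source E x)
  rw [← e1, ← e2]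
  exact congrArg₂ (· + ·) (wedge_comp _ _ _ _).symm
    (congrArg ((-1 : ℝ) ^ j * ·) (wedge_comp _ _ _ _).symm)

end Forms

/-- A good cover: an open cover all of whose nonempty finite intersections are contractible. -/
structure GoodCover (X : Type*) [TopologicalSpace X] (ι : Type*) where
  /-- the members of the cover -/
  U : ι → Opens X
  covers : ∀ x, ∃ i, x ∈ U i
  contractible : ∀ (p : ℕ) (i : Fin (p + 1) → ι), (⋂ t, (U (i t) : Set X)).Nonempty →
    ContractibleSpace ↥(⋂ t, (U (i t) : Set X))

/-- The intersection `U_{i_0} ∩ ... ∩ U_{i_p}`. -/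
def GoodCover.inter {X : Type*} [TopologicalSpace X] {ι : Type*} (𝒰 : GoodCover X ι) {p : ℕ}
    (i : Fin (p + 1) → ι) : Opens X :=
  ⟨⋂ t, (𝒰.U (i t) : Set X), isOpen_iInter_of_finite fun t => (𝒰.U (i t)).isOpen⟩

theorem GoodCover.inter_le {X : Type*} [TopologicalSpace X] {ι : Type*} (𝒰 : GoodCover X ι)
    {p p' : ℕ} (i : Fin (p + 1) → ι) (f : Fin (p' + 1) → Fin (p + 1)) :
    𝒰.inter i ≤ 𝒰.inter (i ∘ f) := fun _ hx =>
  Set.mem_iInter.2 fun t => Set.mem_iInter.1 hx (f t)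

section Cech

variable {E : Type*} [NormedAddCommGroup E] [NormedSpace ℝ E]
  {X : Type*} [TopologicalSpace X] [ChartedSpace E X] {ι : Type*}

/-- The Cech cochains `C^p(𝒰, ℰ^q)` with values in the smooth `q`-forms. -/
abbrev Cech (E : Type*) [NormedAddCommGroup E] [NormedSpace ℝ E]
    {X : Type*} [TopologicalSpace X] [ChartedSpace E X] {ι : Type*} (𝒰 : GoodCover X ι)
    (p q : ℕ) := ∀ i : Fin (p + 1) → ι, DForm E (𝒰.inter i) q

variable {𝒰 : GoodCover X ι}

/-- The Cech differential `(δa)_{i_0 ... i_{p+1}} = ∑ (-1)^t a_{i_0 ... î_t ... i_{p+1}}`. -/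
noncomputable def cechDelta {p q : ℕ} : Cech E 𝒰 p q →+ Cech E 𝒰 (p + 1) q :=
  AddMonoidHom.mk' (fun a i => ∑ t : Fin (p + 1 + 1),
      (-1 : ℤ) ^ (t : ℕ) • res (𝒰.inter_le i t.succAbove) (a (i ∘ t.succAbove)))
    fun a b => by
      funext i
      refine Eq.trans (Finset.sum_congr rfl fun t _ => ?_) Finset.sum_add_distrib
      rw [Pi.add_apply, map_add, zsmul_add]

/-- The exterior derivative on Cech cochains. -/
noncomputable def cechD [IsManifold 𝓘(ℝ, E) ∞ X] {p q : ℕ} :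
    Cech E 𝒰 p q →+ Cech E 𝒰 p (q + 1) :=
  AddMonoidHom.mk' (fun a i => extD (a i)) fun a b => by funext i; simp

/-- The product `(a ∧ b)_{i_0 ... i_{r+s}} = a_{i_0 ... i_r} ∧ b_{i_r ... i_{r+s}}`, without the
sign of the cup product. -/
noncomputable def cechWedge [FiniteDimensional ℝ E] {r j s k : ℕ} :
    Cech E 𝒰 r j →+ Cech E 𝒰 s k →+ Cech E 𝒰 (r + s) (j + k) :=
  AddMonoidHom.mk' (fun a => AddMonoidHom.mk' (fun b i =>
      wedgeForm (res (𝒰.inter_le i (front r s)) (a (i ∘ front r s)))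
        (res (𝒰.inter_le i (back r s)) (b (i ∘ back r s))))
    fun b b' => by funext i; simp)
    fun a a' => by ext b i : 2; simp

variable (E 𝒰) in
/-- The total group `⨁ C^p(𝒰, ℰ^q)` of the Cech-de Rham bicomplex. -/
def Tot := ⨁ pq : ℕ × ℕ, Cech E 𝒰 pq.1 pq.2

noncomputable instance : AddCommGroup (Tot E 𝒰) :=
  inferInstanceAs (AddCommGroup (⨁ pq : ℕ × ℕ, Cech E 𝒰 pq.1 pq.2))

/-- The component of bidegree `(p, q)`. -/
noncomputable def Tot.coeff (p q : ℕ) : Tot E 𝒰 →+ Cech E 𝒰 p q :=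
  DFinsupp.evalAddMonoidHom (β := fun pq : ℕ × ℕ => Cech E 𝒰 pq.1 pq.2) (p, q)

/-- The inclusion of the summand of bidegree `(p, q)`. -/
noncomputable def bi (p q : ℕ) : Cech E 𝒰 p q →+ Tot E 𝒰 :=
  DirectSum.of (fun pq : ℕ × ℕ => Cech E 𝒰 pq.1 pq.2) (p, q)

/-- The total differential `D = δ + (-1)^p d`. -/
noncomputable def totD [IsManifold 𝓘(ℝ, E) ∞ X] : Tot E 𝒰 →+ Tot E 𝒰 :=
  DirectSum.toAddMonoid fun pq =>
    (bi (E := E) (𝒰 := 𝒰) (pq.1 + 1) pq.2).comp cechDelta +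
      (-1 : ℤ) ^ pq.1 • (bi (E := E) (𝒰 := 𝒰) pq.1 (pq.2 + 1)).comp cechD

/-- The cup product with a fixed cochain of bidegree `(r, j)` on the left. -/
noncomputable def cupLeft [FiniteDimensional ℝ E] {r j : ℕ} (a : Cech E 𝒰 r j) :
    Tot E 𝒰 →+ Tot E 𝒰 :=
  DirectSum.toAddMonoid fun sk => (-1 : ℤ) ^ (j * sk.1) •
    (bi (E := E) (𝒰 := 𝒰) (r + sk.1) (j + sk.2)).comp (cechWedge a)

theorem cupLeft_bi [FiniteDimensional ℝ E] {r j s k : ℕ} (a : Cech E 𝒰 r j)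
    (b : Cech E 𝒰 s k) :
    cupLeft a (bi s k b) = (-1 : ℤ) ^ (j * s) • bi (r + s) (j + k) (cechWedge a b) :=
  (DirectSum.toAddMonoid_of (β := fun pq : ℕ × ℕ => Cech E 𝒰 pq.1 pq.2) _ (s, k) b).trans rfl

theorem tot_induction {P : Tot E 𝒰 → Prop} (h0 : P 0) (hb : ∀ p q a, P (bi p q a))
    (ha : ∀ x y, P x → P y → P (x + y)) (x : Tot E 𝒰) : P x :=
  DirectSum.induction_on x h0 (fun pq a => hb pq.1 pq.2 a) ha

/-- The cup product `(a ∪ b)_{i_0 ... i_{r+s}} = (-1)^{js} a_{i_0 ... i_r} ∧ b_{i_r ... i_{r+s}}`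
for `a` of bidegree `(r, j)` and `b` of bidegree `(s, k)`. -/
noncomputable def cup [FiniteDimensional ℝ E] : Tot E 𝒰 →+ Tot E 𝒰 →+ Tot E 𝒰 :=
  DirectSum.toAddMonoid fun rj => AddMonoidHom.mk'
    (fun a : Cech E 𝒰 rj.1 rj.2 => cupLeft a) fun a a' => AddMonoidHom.ext fun b => by
      induction b using tot_induction with
      | h0 => simp
      | ha x y hx hy => rw [map_add, hx, hy, map_add]
      | hb s k b =>
        rw [AddMonoidHom.add_apply, cupLeft_bi, cupLeft_bi, cupLeft_bi, map_add,
          AddMonoidHom.add_apply, map_add, smul_add]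

theorem totD_bi [IsManifold 𝓘(ℝ, E) ∞ X] {p q : ℕ} (a : Cech E 𝒰 p q) :
    totD (bi p q a) = bi (p + 1) q (cechDelta a) + (-1 : ℤ) ^ p • bi p (q + 1) (cechD a) :=
  (DirectSum.toAddMonoid_of (β := fun pq : ℕ × ℕ => Cech E 𝒰 pq.1 pq.2) _ (p, q) a).trans rfl

theorem cup_bi [FiniteDimensional ℝ E] {r j s k : ℕ} (a : Cech E 𝒰 r j) (b : Cech E 𝒰 s k) :
    cup (bi r j a) (bi s k b) = (-1 : ℤ) ^ (j * s) • bi (r + s) (j + k) (cechWedge a b) :=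
  (DFunLike.congr_fun (DirectSum.toAddMonoid_of (β := fun pq : ℕ × ℕ => Cech E 𝒰 pq.1 pq.2) _
    (r, j) a) (bi s k b)).trans (cupLeft_bi a b)

/-- Multiplication by `(-1)^(p+q)` in bidegree `(p, q)`. -/
noncomputable def totSign : Tot E 𝒰 →+ Tot E 𝒰 :=
  DirectSum.toAddMonoid fun pq => (-1 : ℤ) ^ (pq.1 + pq.2) • bi (E := E) (𝒰 := 𝒰) pq.1 pq.2

theorem totSign_bi {p q : ℕ} (a : Cech E 𝒰 p q) :
    totSign (bi p q a) = (-1 : ℤ) ^ (p + q) • bi p q a :=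
  (DirectSum.toAddMonoid_of (β := fun pq : ℕ × ℕ => Cech E 𝒰 pq.1 pq.2) _ (p, q) a).trans rfl

theorem cech_ext {p q : ℕ} {a b : Cech E 𝒰 p q}
    (h : ∀ i, ∀ x ∈ 𝒰.inter i, ∀ v : Fin q → TangentSpace 𝓘(ℝ, E) x,
      (a i).1 x v = (b i).1 x v) : a = b :=
  funext fun i => DForm.ext' fun x hx => ContinuousAlternatingMap.ext (h i x hx)

/-- Transport of a cochain along equalities of the degrees. -/
theorem exists_cast {p q p' q' : ℕ} (hp : p' = p) (hq : q' = q) (a : Cech E 𝒰 p q) :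
    ∃ a' : Cech E 𝒰 p' q', bi p' q' a' = bi p q a ∧ ∀ i x (v : Fin q' → TangentSpace 𝓘(ℝ, E) x),
      (a' i).1 x v = (a (i ∘ Fin.cast (by rw [hp]))).1 x (v ∘ Fin.cast hq.symm) := by
  subst hp hq
  exact ⟨a, rfl, fun i x v => rfl⟩

theorem bi_comb {p q : ℕ} (n : ℕ) {c c₁ c₂ : Cech E 𝒰 p q} (h : ∀ i, ∀ x ∈ 𝒰.inter i,
    ∀ v : Fin q → TangentSpace 𝓘(ℝ, E) x,
      (c i).1 x v = (c₁ i).1 x v + ((-1 : ℤ) ^ n • c₂ i).1 x v) :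
    bi p q c = bi p q c₁ + (-1 : ℤ) ^ n • bi p q c₂ := by
  have : c = c₁ + (-1 : ℤ) ^ n • c₂ := cech_ext h
  rw [this, map_add, map_zsmul]

theorem dform_sum_apply {V : Opens X} {q : ℕ} {κ : Type*} (s : Finset κ) (f : κ → DForm E V q)
    (x : X) (v : Fin q → TangentSpace 𝓘(ℝ, E) x) :
    (∑ t ∈ s, f t).1 x v = ∑ t ∈ s, (f t).1 x v := by
  classical
  induction s using Finset.induction_on with
  | empty => rfl
  | insert t s ht ih =>
    rw [Finset.sum_insert ht, Finset.sum_insert ht, ← ih]; rfl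

theorem dform_sign_apply {V : Opens X} {q : ℕ} (n : ℕ) (w : DForm E V q)
    (x : X) (v : Fin q → TangentSpace 𝓘(ℝ, E) x) :
    ((-1 : ℤ) ^ n • w).1 x v = (-1 : ℝ) ^ n * w.1 x v := by
  rcases Nat.even_or_odd n with h | h
  · simp [h.neg_one_pow]
  · rw [h.neg_one_pow, h.neg_one_pow, neg_one_zsmul, neg_one_mul]; rfl

theorem cechDelta_apply {p q : ℕ} (a : Cech E 𝒰 p q) {i : Fin (p + 1 + 1) → ι} {x : X}
    (hx : x ∈ 𝒰.inter i) (v : Fin q → TangentSpace 𝓘(ℝ, E) x) :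
    (cechDelta a i).1 x v =
      ∑ t : Fin (p + 1 + 1), (-1 : ℝ) ^ (t : ℕ) * (a (i ∘ t.succAbove)).1 x v := by
  refine (dform_sum_apply _ _ x v).trans (Finset.sum_congr rfl fun t _ => ?_)
  rw [dform_sign_apply, res_apply _ _ hx]

theorem cechWedge_apply [FiniteDimensional ℝ E] {r j s k : ℕ} (a : Cech E 𝒰 r j)
    (b : Cech E 𝒰 s k) {i : Fin (r + s + 1) → ι} {x : X} (hx : x ∈ 𝒰.inter i) :
    (cechWedge a b i).1 x = wedge (E := TangentSpace 𝓘(ℝ, E) x) ((a (i ∘ front r s)).1 x)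
      ((b (i ∘ back r s)).1 x) := by
  refine (wedgeForm_apply _ _ hx).trans ?_
  rw [res_apply _ _ hx, res_apply _ _ hx]

theorem cechDelta_cechDelta {p q : ℕ} (a : Cech E 𝒰 p q) : cechDelta (cechDelta a) = 0 := by
  refine cech_ext fun i x hx v => ?_
  rw [cechDelta_apply _ hx]
  refine Eq.trans (Finset.sum_congr rfl fun t _ => ?_)
    (sum_delta_delta (fun j => (a j).1 x v) i)
  rw [cechDelta_apply _ (𝒰.inter_le _ _ hx)]

theorem wedge_sum_left {V : Type*} [AddCommGroup V] [Module ℝ V] [TopologicalSpace V]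
    {j m n : ℕ} (a : Fin n → V [⋀^Fin j]→L[ℝ] ℝ) (c : Fin n → ℝ) (a' : V [⋀^Fin j]→L[ℝ] ℝ)
    (b : V [⋀^Fin m]→L[ℝ] ℝ) (h : ∀ u, a' u = ∑ t, c t * a t u) (v : Fin (j + m) → V) :
    wedge a' b v = ∑ t, c t * wedge (a t) b v := by
  simp only [wedge_apply, h, Finset.sum_mul, Finset.mul_sum]
  rw [Finset.sum_comm]
  exact Finset.sum_congr rfl fun t _ => Finset.sum_congr rfl fun σ _ => by ring

theorem wedge_sum_right {V : Type*} [AddCommGroup V] [Module ℝ V] [TopologicalSpace V]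
    {j m n : ℕ} (a : V [⋀^Fin j]→L[ℝ] ℝ) (b : Fin n → V [⋀^Fin m]→L[ℝ] ℝ) (c : Fin n → ℝ)
    (b' : V [⋀^Fin m]→L[ℝ] ℝ) (h : ∀ u, b' u = ∑ t, c t * b t u) (v : Fin (j + m) → V) :
    wedge a b' v = ∑ t, c t * wedge a (b t) v := by
  simp only [wedge_apply, h, Finset.mul_sum]
  rw [Finset.sum_comm]
  exact Finset.sum_congr rfl fun t _ => Finset.sum_congr rfl fun σ _ => by ring

theorem bi_delta_wedge [FiniteDimensional ℝ E] {r j s k : ℕ} (a : Cech E 𝒰 r j)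
    (b : Cech E 𝒰 s k) :
    bi (r + s + 1) (j + k) (cechDelta (cechWedge a b)) =
      bi (r + 1 + s) (j + k) (cechWedge (cechDelta a) b) +
        (-1 : ℤ) ^ r • bi (r + (s + 1)) (j + k) (cechWedge a (cechDelta b)) := by
  obtain ⟨c, hc, hc'⟩ := exists_cast (show r + s + 1 = r + 1 + s by omega) rfl
    (cechWedge (cechDelta a) b)
  rw [← hc]
  refine bi_comb (p := r + s + 1) (c₂ := cechWedge a (cechDelta b)) r fun i x hx v => ?_
  refine Eq.trans ?_ (congrArg₂ (· + ·) (hc' i x v).symm (dform_sign_apply r _ x v).symm)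
  rw [cechDelta_apply _ hx]
  have e1 := sum_delta_leibniz (fun A B => wedge (E := TangentSpace 𝓘(ℝ, E) x)
    ((a A).1 x) ((b B).1 x) v) i
  refine Eq.trans (Finset.sum_congr rfl fun t _ => ?_) (e1.trans ?_)
  · rw [cechWedge_apply _ _ (𝒰.inter_le _ _ hx)]
  · congr 1
    · rw [cechWedge_apply _ _ (𝒰.inter_le i (Fin.cast _) hx)]
      refine (wedge_sum_left _ _ _ _ (fun u => ?_) v).symm
      exact cechDelta_apply _ (𝒰.inter_le _ _ (𝒰.inter_le i (Fin.cast _) hx)) u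
    · congr 1
      refine Eq.trans ?_ (congrArg (fun F => F v) (cechWedge_apply a (cechDelta b) hx)).symm
      refine (wedge_sum_right _ _ _ _ (fun u => ?_) v).symm
      exact cechDelta_apply _ (𝒰.inter_le i (back r (s + 1)) hx) u

variable [IsManifold 𝓘(ℝ, E) ∞ X]

theorem bi_d_wedge [FiniteDimensional ℝ E] {r j s k : ℕ} (a : Cech E 𝒰 r j)
    (b : Cech E 𝒰 s k) :
    bi (r + s) (j + k + 1) (cechD (cechWedge a b)) =
      bi (r + s) (j + 1 + k) (cechWedge (cechD a) b) +
        (-1 : ℤ) ^ j • bi (r + s) (j + (k + 1)) (cechWedge a (cechD b)) := by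
  obtain ⟨c, hc, hc'⟩ := exists_cast rfl (show j + k + 1 = j + 1 + k by omega)
    (cechWedge (cechD a) b)
  rw [← hc]
  refine bi_comb (q := j + k + 1) (c₂ := cechWedge a (cechD b)) j fun i x hx v => ?_
  refine Eq.trans ?_ (congrArg₂ (· + ·) (hc' i x v).symm (dform_sign_apply j _ x v).symm)
  refine (extD_wedge _ _ hx v).trans ?_
  rw [extD_res, extD_res]
  rfl

theorem cechD_cechD {p q : ℕ} (a : Cech E 𝒰 p q) : cechD (cechD a) = 0 :=
  funext fun i => extD_extD (a i)

theorem cechD_cechDelta {p q : ℕ} (a : Cech E 𝒰 p q) :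
    cechD (cechDelta a) = cechDelta (cechD a) := by
  funext i
  simp [cechD, cechDelta, extD_res]

theorem totD_totD (a : Tot E 𝒰) : totD (totD a) = 0 := by
  induction a using tot_induction with
  | h0 => simp
  | hb p q a =>
    simp only [totD_bi, map_add, map_zsmul, cechD_cechD, cechDelta_cechDelta, cechD_cechDelta,
      map_zero, smul_zero, add_zero, zero_add, pow_succ]
    simp
  | ha x y hx hy => rw [map_add, map_add, hx, hy, add_zero]

/-- The graded Leibniz rule for the cup product. -/
theorem totD_cup [FiniteDimensional ℝ E] (a b : Tot E 𝒰) :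
    totD (cup a b) = cup (totD a) b + cup (totSign a) (totD b) := by
  induction a using tot_induction with
  | h0 => simp
  | ha x y hx hy =>
    simp only [map_add, AddMonoidHom.add_apply, hx, hy]; abel
  | hb r j a =>
    induction b using tot_induction with
    | h0 => simp
    | ha x y hx hy => simp only [map_add, hx, hy]; abel
    | hb s k b =>
      simp only [totD_bi, cup_bi, totSign_bi, map_add, map_zsmul, AddMonoidHom.add_apply,
        AddMonoidHom.zsmul_apply, bi_delta_wedge, bi_d_wedge, smul_add, smul_smul]
      have hj : (-1 : ℤ) ^ j * (-1) ^ j = 1 := by rw [← mul_pow]; simp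
      have e1 : (-1 : ℤ) ^ (r + j) * (-1) ^ (j * (s + 1)) = (-1) ^ (j * s) * (-1) ^ r := by
        rw [mul_add, pow_add, pow_add, mul_one]; linear_combination ((-1) ^ r * (-1) ^ (j * s)) * hj
      have e2 : (-1 : ℤ) ^ r * (-1) ^ ((j + 1) * s) = (-1) ^ (j * s) * (-1) ^ (r + s) := by
        rw [add_mul, pow_add, pow_add]; ring
      have e3 : (-1 : ℤ) ^ s * ((-1) ^ (r + j) * (-1) ^ (j * s)) =
          (-1) ^ (j * s) * ((-1) ^ (r + s) * (-1) ^ j) := by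
        rw [pow_add, pow_add]; ring
      simp only [e1, e2, e3]
      abel

end Cech

section Sparks

variable {E : Type*} [NormedAddCommGroup E] [NormedSpace ℝ E]
  {X : Type*} [TopologicalSpace X] [ChartedSpace E X] {ι : Type*} {𝒰 : GoodCover X ι}

variable (E 𝒰) in
/-- The elements of total degree `k`; this is zero for `k < 0`. -/
def totDeg (k : ℤ) : AddSubgroup (Tot E 𝒰) where
  carrier := {a | ∀ p q : ℕ, (p + q : ℤ) ≠ k → Tot.coeff p q a = 0}
  zero_mem' := fun _ _ _ => map_zero _
  add_mem' := fun ha hb p q h => by rw [map_add, ha p q h, hb p q h, add_zero]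
  neg_mem' := fun ha p q h => by rw [map_neg, ha p q h, neg_zero]

variable (E 𝒰) in
/-- The Cech cochains `C^p(𝒰, ℤ)`, as the subgroup of `C^p(𝒰, ℰ^0)` of integer valued functions.
A smooth integer valued function is locally constant, so these are the sections of the constant
sheaf `ℤ` over the intersections of the cover. -/
def IntCochain (p : ℕ) : AddSubgroup (Cech E 𝒰 p 0) where
  carrier := {c | ∀ i, ∀ x ∈ 𝒰.inter i, ∃ m : ℤ, ∀ v, (c i).1 x v = m}
  zero_mem' := fun _ _ _ => ⟨0, fun _ => by simp⟩
  add_mem' := fun ha hb i x hx => by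
    obtain ⟨m, hm⟩ := ha i x hx
    obtain ⟨n, hn⟩ := hb i x hx
    exact ⟨m + n, fun v => by push_cast; rw [← hm v, ← hn v]; rfl⟩
  neg_mem' := fun ha i x hx => by
    obtain ⟨m, hm⟩ := ha i x hx
    exact ⟨-m, fun v => by push_cast; rw [← hm v]; rfl⟩

/-- The Cech 0-cochain of the restrictions of a global form. -/
noncomputable def restrictAll (q : ℕ) : DForm E (⊤ : Opens X) q →+ Cech E 𝒰 0 q :=
  AddMonoidHom.mk' (fun w _ => res le_top w) fun a b => by funext i; simp

/-- The inclusion of the global forms `ℰ^q(X)` into the total complex, in bidegree `(0, q)`. -/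
noncomputable def globalForm (q : ℕ) : DForm E (⊤ : Opens X) q →+ Tot E 𝒰 :=
  (bi 0 q).comp (restrictAll q)

theorem globalForm_def {q : ℕ} (w : DForm E (⊤ : Opens X) q) :
    globalForm (𝒰 := 𝒰) q w = bi 0 q (restrictAll q w) := rfl

theorem restrictAll_apply {q : ℕ} (w : DForm E (⊤ : Opens X) q) (i : Fin 1 → ι) {x : X}
    (hx : x ∈ 𝒰.inter i) : (restrictAll (𝒰 := 𝒰) q w i).1 x = w.1 x :=
  res_apply (W := 𝒰.inter i) le_top w hx

variable [IsManifold 𝓘(ℝ, E) ∞ X]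

variable (E 𝒰) in
/-- Smooth hypersparks of degree `k`: elements `a` of total degree `k` together with a global form
`e` and an integer cochain `r` of degree `k + 1` such that `D a = e - r`. The pair `(e, r)` is
determined by `a`, see `spark_ext`. -/
def Spark (k : ℕ) :
    AddSubgroup (Tot E 𝒰 × DForm E (⊤ : Opens X) (k + 1) × IntCochain E 𝒰 (k + 1)) where
  carrier := {σ | σ.1 ∈ totDeg E 𝒰 k ∧
    totD σ.1 = globalForm (k + 1) σ.2.1 - bi (k + 1) 0 σ.2.2.1}
  zero_mem' := ⟨zero_mem _, by simp⟩
  add_mem' := fun ha hb => ⟨add_mem ha.1 hb.1, by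
    simp only [Prod.fst_add, Prod.snd_add, map_add, AddSubgroup.coe_add, ha.2, hb.2]; abel⟩
  neg_mem' := fun ha => ⟨neg_mem ha.1, by
    simp only [Prod.fst_neg, Prod.snd_neg, map_neg, AddSubgroup.coe_neg, ha.2]; abel⟩

noncomputable instance (k : ℕ) : AddCommGroup (Spark E 𝒰 k) := AddSubgroup.toAddCommGroup _

variable (E 𝒰) in
/-- The hypersparks equivalent to zero: those with `a = D b + s`, where `b` has total degree
`k - 1` and `s` is an integer cochain of degree `k`. -/
def trivialSparks (k : ℕ) : AddSubgroup (Spark E 𝒰 k) where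
  carrier := {σ | ∃ b ∈ totDeg E 𝒰 ((k : ℤ) - 1), ∃ s ∈ IntCochain E 𝒰 k,
    σ.1.1 = totD b + bi k 0 s}
  zero_mem' := ⟨0, zero_mem _, 0, zero_mem _, by simp⟩
  add_mem' := by
    rintro σ τ ⟨b, hb, s, hs, h⟩ ⟨b', hb', s', hs', h'⟩
    refine ⟨b + b', add_mem hb hb', s + s', add_mem hs hs', ?_⟩
    simp only [AddSubgroup.coe_add, Prod.fst_add, h, h', map_add]; abel
  neg_mem' := by
    rintro σ ⟨b, hb, s, hs, h⟩
    refine ⟨-b, neg_mem hb, -s, neg_mem hs, ?_⟩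
    simp only [AddSubgroup.coe_neg, Prod.fst_neg, h, map_neg]; abel

variable (E 𝒰) in
/-- The group of smooth hyperspark classes of degree `k`. -/
def SparkClass (k : ℕ) := Spark E 𝒰 k ⧸ trivialSparks E 𝒰 k

noncomputable instance (k : ℕ) : AddCommGroup (SparkClass E 𝒰 k) :=
  inferInstanceAs (AddCommGroup (Spark E 𝒰 k ⧸ trivialSparks E 𝒰 k))

/-- The class of a spark. -/
noncomputable def sparkClass (k : ℕ) : Spark E 𝒰 k →+ SparkClass E 𝒰 k :=
  QuotientAddGroup.mk' (trivialSparks E 𝒰 k)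

/-- A homomorphism that vanishes on the trivial sparks descends to spark classes. -/
noncomputable def sparkLift {k : ℕ} {G : Type*} [AddCommGroup G] (F : Spark E 𝒰 k →+ G)
    (hF : ∀ σ ∈ trivialSparks E 𝒰 k, F σ = 0) : SparkClass E 𝒰 k →+ G :=
  QuotientAddGroup.lift (trivialSparks E 𝒰 k) F hF

theorem sparkClass_surjective (k : ℕ) :
    Function.Surjective (sparkClass (E := E) (𝒰 := 𝒰) k) :=
  QuotientAddGroup.mk'_surjective _

theorem sparkLift_class {k : ℕ} {G : Type*} [AddCommGroup G] (F : Spark E 𝒰 k →+ G)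
    (hF : ∀ σ ∈ trivialSparks E 𝒰 k, F σ = 0) (σ : Spark E 𝒰 k) :
    sparkLift F hF (sparkClass k σ) = F σ := rfl

theorem sparkClass_eq_zero {k : ℕ} {σ : Spark E 𝒰 k} :
    sparkClass k σ = 0 ↔ σ ∈ trivialSparks E 𝒰 k :=
  QuotientAddGroup.eq_zero_iff σ

variable (E 𝒰) in
/-- The Cech cocycles in `C^(k+1)(𝒰, ℤ)`. -/
noncomputable def intCocycles (k : ℕ) : AddSubgroup (IntCochain E 𝒰 (k + 1)) :=
  ((cechDelta (E := E) (𝒰 := 𝒰) (p := k + 1) (q := 0)).comp (IntCochain E 𝒰 (k + 1)).subtype).ker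

variable (E 𝒰) in
/-- The Cech coboundaries in `C^(k+1)(𝒰, ℤ)`. -/
def intCoboundaries (k : ℕ) : AddSubgroup (intCocycles E 𝒰 k) where
  carrier := {r | ∃ t ∈ IntCochain E 𝒰 k, cechDelta t = r.1.1}
  zero_mem' := ⟨0, zero_mem _, by simp⟩
  add_mem' := by
    rintro _ _ ⟨t, ht, h⟩ ⟨t', ht', h'⟩
    exact ⟨t + t', add_mem ht ht', by rw [map_add, h, h']; rfl⟩
  neg_mem' := by
    rintro _ ⟨t, ht, h⟩
    exact ⟨-t, neg_mem ht, by rw [map_neg, h]; rfl⟩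

variable (E 𝒰) in
/-- The Cech cohomology group `H^(k+1)(𝒰, ℤ)`. -/
def IntCohomology (k : ℕ) := intCocycles E 𝒰 k ⧸ intCoboundaries E 𝒰 k

noncomputable instance (k : ℕ) : AddCommGroup (IntCohomology E 𝒰 k) :=
  inferInstanceAs (AddCommGroup (intCocycles E 𝒰 k ⧸ intCoboundaries E 𝒰 k))

/-- The cohomology class of an integer cocycle. -/
noncomputable def intClass (k : ℕ) : intCocycles E 𝒰 k →+ IntCohomology E 𝒰 k :=
  QuotientAddGroup.mk' (intCoboundaries E 𝒰 k)

/-! Consequences of the spark equation. -/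

theorem coeff_bi {p q : ℕ} (a : Cech E 𝒰 p q) : Tot.coeff p q (bi p q a) = a :=
  DirectSum.of_eq_same (β := fun pq : ℕ × ℕ => Cech E 𝒰 pq.1 pq.2) (p, q) a

theorem coeff_bi_ne {p q p' q' : ℕ} (a : Cech E 𝒰 p q) (h : (p, q) ≠ (p', q')) :
    Tot.coeff p' q' (bi p q a) = 0 :=
  DirectSum.of_eq_of_ne (β := fun pq : ℕ × ℕ => Cech E 𝒰 pq.1 pq.2) (p, q) (p', q') a h.symm

theorem globalForm_injective (q : ℕ) {w : DForm E (⊤ : Opens X) q}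
    (h : globalForm (𝒰 := 𝒰) q w = 0) : w = 0 := by
  refine DForm.ext' fun x _ => ?_
  obtain ⟨i, hi⟩ := 𝒰.covers x
  have h1 := congrArg (Tot.coeff 0 q) h
  rw [globalForm_def, coeff_bi, map_zero] at h1
  have hx : x ∈ 𝒰.inter (fun _ : Fin 1 => i) := Set.mem_iInter.2 fun _ => hi
  rw [← restrictAll_apply (𝒰 := 𝒰) w (fun _ => i) hx, h1]
  rfl

theorem globalForm_eq_bi {p q : ℕ} {w : DForm E (⊤ : Opens X) (q + 1)}
    {r : Cech E 𝒰 (p + 1) 0} (h : globalForm (q + 1) w = bi (p + 1) 0 r) : w = 0 ∧ r = 0 := by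
  have h2 := congrArg (Tot.coeff (p + 1) 0) h
  rw [coeff_bi, globalForm_def, coeff_bi_ne _ (by simp)] at h2
  subst h2
  rw [map_zero] at h
  exact ⟨globalForm_injective (𝒰 := 𝒰) _ h, rfl⟩

theorem spark_ext {k : ℕ} {σ τ : Spark E 𝒰 k} (h : σ.1.1 = τ.1.1) : σ = τ := by
  have h1 := σ.2.2.symm.trans ((congrArg totD h).trans τ.2.2)
  have h2 : globalForm (k + 1) (σ.1.2.1 - τ.1.2.1) =
      bi (k + 1) 0 (σ.1.2.2.1 - τ.1.2.2.1 : Cech E 𝒰 (k + 1) 0) := by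
    rw [map_sub, map_sub, sub_eq_sub_iff_sub_eq_sub]; exact h1
  obtain ⟨h3, h4⟩ := globalForm_eq_bi h2
  exact Subtype.ext (Prod.ext h (Prod.ext (sub_eq_zero.1 h3) (Subtype.ext (sub_eq_zero.1 h4))))

theorem totD_globalForm {q : ℕ} (w : DForm E (⊤ : Opens X) q) :
    totD (globalForm (𝒰 := 𝒰) q w) = globalForm (q + 1) (extD w) := by
  have h1 : cechDelta (restrictAll (𝒰 := 𝒰) q w) = 0 := by
    refine cech_ext fun i x hx v => ?_
    rw [cechDelta_apply _ hx, Fin.sum_univ_two, restrictAll_apply _ _ (𝒰.inter_le _ _ hx),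
      restrictAll_apply _ _ (𝒰.inter_le _ _ hx)]
    simp
  have h2 : cechD (restrictAll (𝒰 := 𝒰) q w) = restrictAll (q + 1) (extD w) :=
    funext fun i => extD_res (W := 𝒰.inter i) le_top w
  rw [globalForm_def, totD_bi, h1, h2, map_zero, zero_add, pow_zero, one_smul, globalForm_def]

theorem extD_int {V : Opens X} (w : DForm E V 0)
    (h : ∀ x ∈ V, ∃ m : ℤ, ∀ v, w.1 x v = m) : extD w = 0 := by
  refine DForm.ext' fun x hx => ?_
  rw [extD_apply _ hx]
  set φ := chartAt E x with hφ
  have hc := chartAt_mem_chartDom (E := E) hx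
  have hint : ∀ y ∈ chartDom φ V, ∃ m : ℤ, ∀ v, localRep φ w.1 y v = m := fun y hy => by
    obtain ⟨m, hm⟩ := h _ hy.2
    exact ⟨m, fun v => hm _⟩
  have hcont : ContinuousAt (fun y => localRep φ w.1 y ![]) (φ x) := by
    have h1 := (diffAt_localRep w (chart_mem_atlas E x) hc).continuousAt
    exact (ContinuousAlternatingMap.apply ℝ E ℝ (![] : Fin 0 → E)).continuous.continuousAt.comp h1
  have hev : localRep φ w.1 =ᶠ[𝓝 (φ x)] fun _ => localRep φ w.1 (φ x) := by
    have h1 := Metric.continuousAt_iff.1 hcont 1 one_pos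
    obtain ⟨δ, hδ, h1⟩ := h1
    filter_upwards [Metric.ball_mem_nhds _ hδ, (isOpen_chartDom φ V).mem_nhds hc] with y hy hy'
    obtain ⟨m, hm⟩ := hint _ hc
    obtain ⟨n, hn⟩ := hint y hy'
    have h2 := h1 hy
    rw [hn, hm, Real.dist_eq] at h2
    have h3 : n = m := by
      have : |n - m| < 1 := by exact_mod_cast h2
      rw [Int.abs_lt_one_iff] at this; omega
    ext v
    rw [hn v, hm v, h3]
  have h5 : extDeriv (fun _ : E => localRep φ w.1 (φ x)) (φ x) = 0 := by
    ext v
    rw [extDeriv_apply (differentiableAt_const _)]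
    simp
  simp only [rawD, ← hφ, hev.extDeriv_eq, h5]
  rfl

theorem totD_int {p : ℕ} {r : Cech E 𝒰 p 0} (hr : r ∈ IntCochain E 𝒰 p) :
    totD (bi p 0 r) = bi (p + 1) 0 (cechDelta r) := by
  have : cechD r = 0 := funext fun i => extD_int _ (hr i)
  rw [totD_bi, this, map_zero, smul_zero, add_zero]

theorem spark_closed {k : ℕ} (σ : Spark E 𝒰 k) :
    extD σ.1.2.1 = 0 ∧ cechDelta σ.1.2.2.1 = 0 := by
  have h := congrArg totD σ.2.2
  rw [totD_totD, map_sub, totD_globalForm, totD_int σ.1.2.2.2] at h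
  exact globalForm_eq_bi (sub_eq_zero.1 h.symm)

theorem trivial_spark {k : ℕ} {σ : Spark E 𝒰 k} (h : σ ∈ trivialSparks E 𝒰 k) :
    ∃ b ∈ totDeg E 𝒰 ((k : ℤ) - 1), ∃ s ∈ IntCochain E 𝒰 k, σ.1.1 = totD b + bi k 0 s ∧
      σ.1.2.1 = 0 ∧ σ.1.2.2.1 = -cechDelta s := by
  obtain ⟨b, hb, s, hs, h⟩ := h
  have h1 := σ.2.2
  rw [h, map_add, totD_totD, totD_int hs, zero_add] at h1
  have h2 : globalForm (k + 1) σ.1.2.1 = bi (k + 1) 0 (σ.1.2.2.1 + cechDelta s) := by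
    rw [map_add, h1]; abel
  obtain ⟨h3, h4⟩ := globalForm_eq_bi h2
  exact ⟨b, hb, s, hs, h, h3, eq_neg_of_add_eq_zero_left h4⟩

variable (E 𝒰) in
/-- The homomorphism `δ₁ : Ĥ^k → ℰ^(k+1)(X)`, `[a] ↦ e`. -/
noncomputable def delta1 (k : ℕ) : SparkClass E 𝒰 k →+ DForm E (⊤ : Opens X) (k + 1) :=
  sparkLift (AddMonoidHom.mk' (fun σ => σ.1.2.1) fun _ _ => rfl) fun σ hσ => by
    obtain ⟨_, _, _, _, _, h, _⟩ := trivial_spark hσ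
    exact h

variable (E 𝒰) in
/-- The homomorphism `δ₂ : Ĥ^k → H^(k+1)(𝒰, ℤ)`, `[a] ↦ [r]`. -/
noncomputable def delta2 (k : ℕ) : SparkClass E 𝒰 k →+ IntCohomology E 𝒰 k :=
  sparkLift ((intClass k).comp
    (AddMonoidHom.mk' (fun σ => ⟨σ.1.2.2, (spark_closed σ).2⟩) fun _ _ => rfl)) fun σ hσ => by
    obtain ⟨_, _, s, hs, _, _, h⟩ := trivial_spark hσ
    refine (QuotientAddGroup.eq_zero_iff _).2 ⟨-s, neg_mem hs, ?_⟩
    rw [map_neg]; exact h.symm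

variable (E 𝒰) in
/-- The subgroup `Ĥ^k_∞` of classes that are represented by a spark which is a global smooth
form. -/
noncomputable def smoothClasses (k : ℕ) : AddSubgroup (SparkClass E 𝒰 k) where
  carrier := {α | ∃ σ : Spark E 𝒰 k, (∃ w, σ.1.1 = globalForm k w) ∧ sparkClass k σ = α}
  zero_mem' := ⟨0, ⟨0, by rw [map_zero]; rfl⟩, map_zero _⟩
  add_mem' := by
    rintro _ _ ⟨σ, ⟨w, hw⟩, rfl⟩ ⟨τ, ⟨w', hw'⟩, rfl⟩
    exact ⟨σ + τ, ⟨w + w', by rw [map_add, ← hw, ← hw']; rfl⟩, map_add _ _ _⟩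
  neg_mem' := by
    rintro _ ⟨σ, ⟨w, hw⟩, rfl⟩
    exact ⟨-σ, ⟨-w, by rw [map_neg, ← hw]; rfl⟩, map_neg _ _⟩

/-! Degrees. -/

theorem bi_mem_totDeg {p q : ℕ} {k : ℤ} (h : (p + q : ℤ) = k) (a : Cech E 𝒰 p q) :
    bi p q a ∈ totDeg E 𝒰 k := fun p' q' h' => by
  refine coeff_bi_ne a fun hh => h' ?_
  obtain ⟨rfl, rfl⟩ := Prod.mk.inj hh
  exact h

theorem totDeg_induction {k : ℤ} {H : AddSubgroup (Tot E 𝒰)}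
    (h : ∀ (p q : ℕ) (a : Cech E 𝒰 p q), (p + q : ℤ) = k → bi p q a ∈ H) {a : Tot E 𝒰}
    (ha : a ∈ totDeg E 𝒰 k) : a ∈ H := by
  classical
  have h1 := DirectSum.sum_support_of (β := fun pq : ℕ × ℕ => Cech E 𝒰 pq.1 pq.2) a
  refine h1 ▸ (sum_mem fun pq hpq => h pq.1 pq.2 _ ?_ : _ ∈ H)
  by_contra hne
  exact (DFinsupp.mem_support_iff.1 hpq) (ha pq.1 pq.2 hne)

theorem totD_mem {k : ℤ} {a : Tot E 𝒰} (ha : a ∈ totDeg E 𝒰 k) :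
    totD a ∈ totDeg E 𝒰 (k + 1) := by
  refine totDeg_induction (H := (totDeg E 𝒰 (k + 1)).comap totD) (fun p q a h => ?_) ha
  rw [AddSubgroup.mem_comap, totD_bi]
  exact add_mem (bi_mem_totDeg (by push_cast; omega) _)
    (zsmul_mem (bi_mem_totDeg (by push_cast; omega) _) _)

theorem totSign_eq {k : ℕ} {a : Tot E 𝒰} (ha : a ∈ totDeg E 𝒰 k) :
    totSign a = (-1 : ℤ) ^ k • a := by
  refine totDeg_induction (H := (totSign (E := E) (𝒰 := 𝒰) - (-1 : ℤ) ^ k • AddMonoidHom.id (Tot E 𝒰)).ker)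
    (fun p q a h => ?_) ha |> fun h => sub_eq_zero.1 h
  have : p + q = k := by exact_mod_cast h
  rw [AddMonoidHom.mem_ker, AddMonoidHom.sub_apply, totSign_bi, this, sub_eq_zero]
  rfl

variable [FiniteDimensional ℝ E]

theorem cup_mem {k l : ℤ} {a b : Tot E 𝒰} (ha : a ∈ totDeg E 𝒰 k) (hb : b ∈ totDeg E 𝒰 l) :
    cup a b ∈ totDeg E 𝒰 (k + l) := by
  refine totDeg_induction (H := (totDeg E 𝒰 (k + l)).comap ((cup (E := E) (𝒰 := 𝒰)).flip b)) (fun r j a h => ?_) ha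
  refine totDeg_induction (H := (totDeg E 𝒰 (k + l)).comap (cup (bi r j a))) (fun s m b h' => ?_) hb
  rw [AddSubgroup.mem_comap, cup_bi]
  exact zsmul_mem (bi_mem_totDeg (by push_cast; omega) _) _

theorem globalForm_mem (q : ℕ) (w : DForm E (⊤ : Opens X) q) :
    globalForm q w ∈ totDeg E 𝒰 q := bi_mem_totDeg (by simp) _

theorem cup_globalForm {q m : ℕ} (w : DForm E (⊤ : Opens X) q) (w' : DForm E (⊤ : Opens X) m) :
    cup (globalForm (𝒰 := 𝒰) q w) (globalForm m w') = globalForm (q + m) (wedgeForm w w') := by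
  rw [globalForm_def, globalForm_def, globalForm_def, cup_bi, mul_zero, pow_zero, one_smul]
  refine congrArg (bi (E := E) (𝒰 := 𝒰) 0 (q + m)) (cech_ext fun i x hx v => ?_)
  rw [cechWedge_apply _ _ hx, restrictAll_apply _ _ (𝒰.inter_le i _ hx),
    restrictAll_apply _ _ (𝒰.inter_le i _ hx), restrictAll_apply _ _ hx,
    wedgeForm_apply (V := (⊤ : Opens X)) w w' (Set.mem_univ x)]

theorem cup_int {p p' : ℕ} (r : Cech E 𝒰 p 0) (s : Cech E 𝒰 p' 0) :
    cup (bi p 0 r) (bi p' 0 s) = bi (p + p') 0 (cechWedge r s) := by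
  rw [cup_bi, zero_mul, pow_zero, one_smul]

theorem cechWedge_int {p p' : ℕ} {r : Cech E 𝒰 p 0} {s : Cech E 𝒰 p' 0}
    (hr : r ∈ IntCochain E 𝒰 p) (hs : s ∈ IntCochain E 𝒰 p') :
    (cechWedge r s : Cech E 𝒰 (p + p') 0) ∈ IntCochain E 𝒰 (p + p') := fun i x hx => by
  obtain ⟨m, hm⟩ := hr _ x (𝒰.inter_le i (front p p') hx)
  obtain ⟨n, hn⟩ := hs _ x (𝒰.inter_le i (back p p') hx)
  refine ⟨m * n, fun v => ?_⟩
  rw [cechWedge_apply _ _ hx]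
  refine (wedge_apply _ _ _).trans ?_
  simp only [hm, hn]
  have : (Finset.univ : Finset (Perm (Fin (0 + 0)))) = {1} := by decide
  rw [this]
  simp

theorem totD_cup_deg {k : ℕ} {a : Tot E 𝒰} (ha : a ∈ totDeg E 𝒰 k) (b : Tot E 𝒰) :
    totD (cup a b) = cup (totD a) b + (-1 : ℤ) ^ k • cup a (totD b) := by
  rw [totD_cup, totSign_eq ha, map_zsmul, AddMonoidHom.zsmul_apply]

/-- The cup product of the integer cochains of two sparks. -/
noncomputable def intCup {p p' : ℕ} (r : IntCochain E 𝒰 p) (s : IntCochain E 𝒰 p') :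
    IntCochain E 𝒰 (p + p') := ⟨cechWedge r.1 s.1, cechWedge_int r.2 s.2⟩

theorem neg_one_pow_sq (k : ℕ) : (-1 : ℤ) ^ k * (-1) ^ k = 1 := by rw [← mul_pow]; simp

/-- The product of two sparks: for `D a = e - r` and `D b = f - s`, the spark
`a ∪ f + (-1)^(k+1) r ∪ b` with `D (a ∪ f + (-1)^(k+1) r ∪ b) = e ∧ f - r ∪ s`. -/
noncomputable def sparkMulFn {k l : ℕ} (σ : Spark E 𝒰 k) (τ : Spark E 𝒰 l) :
    Spark E 𝒰 (k + 1 + l) :=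
  ⟨(cup σ.1.1 (globalForm (l + 1) τ.1.2.1) +
      (-1 : ℤ) ^ (k + 1) • cup (bi (k + 1) 0 σ.1.2.2.1) τ.1.1,
    wedgeForm (j := k + 1) (m := l + 1) σ.1.2.1 τ.1.2.1,
    intCup (p := k + 1) (p' := l + 1) σ.1.2.2 τ.1.2.2), by
    have hr : bi (k + 1) 0 σ.1.2.2.1 ∈ totDeg E 𝒰 ((k + 1 : ℕ) : ℤ) :=
      bi_mem_totDeg (by simp) _
    constructor
    · refine add_mem ?_ (zsmul_mem ?_ _)
      · have h := cup_mem σ.2.1 (globalForm_mem (𝒰 := 𝒰) (l + 1) τ.1.2.1)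
        have e : ((k + 1 + l : ℕ) : ℤ) = (k : ℤ) + (l + 1 : ℕ) := by push_cast; ring
        rw [e]; exact h
      · have h := cup_mem hr τ.2.1
        rwa [← Nat.cast_add] at h
    · dsimp only
      rw [map_add, map_zsmul, totD_cup_deg σ.2.1, totD_cup_deg hr, totD_globalForm,
        totD_int σ.1.2.2.2, (spark_closed τ).1, (spark_closed σ).2, σ.2.2, τ.2.2]
      simp only [map_zero, map_sub, AddMonoidHom.sub_apply, AddMonoidHom.zero_apply, smul_zero,
        add_zero, zero_add, smul_smul, neg_one_pow_sq, one_smul, cup_globalForm, cup_int]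
      exact sub_add_sub_cancel _ _ _⟩

theorem sparkMulFn_add_right {k l : ℕ} (σ : Spark E 𝒰 k) (τ τ' : Spark E 𝒰 l) :
    sparkMulFn σ (τ + τ') = sparkMulFn σ τ + sparkMulFn σ τ' := spark_ext (by
  simp only [sparkMulFn, AddSubgroup.coe_add, Prod.fst_add, Prod.snd_add, map_add, smul_add]
  abel)

theorem sparkMulFn_add_left {k l : ℕ} (σ σ' : Spark E 𝒰 k) (τ : Spark E 𝒰 l) :
    sparkMulFn (σ + σ') τ = sparkMulFn σ τ + sparkMulFn σ' τ := spark_ext (by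
  simp only [sparkMulFn, AddSubgroup.coe_add, Prod.fst_add, Prod.snd_add, map_add, smul_add,
    AddMonoidHom.add_apply]
  abel)

theorem sparkMulFn_left {k l : ℕ} {σ : Spark E 𝒰 k} (hσ : σ ∈ trivialSparks E 𝒰 k)
    (τ : Spark E 𝒰 l) : sparkMulFn σ τ ∈ trivialSparks E 𝒰 (k + 1 + l) := by
  obtain ⟨c, hc, t, ht, h, _, hr⟩ := trivial_spark hσ
  have ht' : bi k 0 t ∈ totDeg E 𝒰 (k : ℤ) := bi_mem_totDeg (by simp) _
  obtain ⟨m, hm, hm'⟩ := exists_cast (show k + 1 + l = k + (l + 1) by omega) rfl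
    (cechWedge t τ.1.2.2.1)
  refine ⟨cup c (globalForm (l + 1) τ.1.2.1) + (-1 : ℤ) ^ k • cup (bi k 0 t) τ.1.1,
    add_mem ?_ (zsmul_mem ?_ _), m, fun i x hx => ?_, ?_⟩
  · have h1 := cup_mem hc (globalForm_mem (𝒰 := 𝒰) (l + 1) τ.1.2.1)
    have e : ((k + 1 + l : ℕ) : ℤ) - 1 = (k : ℤ) - 1 + (l + 1 : ℕ) := by push_cast; ring
    rw [e]; exact h1
  · have h1 := cup_mem ht' τ.2.1
    have e : ((k + 1 + l : ℕ) : ℤ) - 1 = (k : ℤ) + l := by push_cast; ring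
    rw [e]; exact h1
  · obtain ⟨n, hn⟩ := cechWedge_int ht τ.1.2.2.2 _ x (𝒰.inter_le i (Fin.cast _) hx)
    exact ⟨n, fun v => (hm' i x v).trans (hn _)⟩
  · have h1 : totD (cup c (globalForm (l + 1) τ.1.2.1)) =
        cup (totD c) (globalForm (l + 1) τ.1.2.1) := by
      rw [totD_cup, totD_globalForm, (spark_closed τ).1, map_zero, map_zero, add_zero]
    rw [map_add, map_zsmul, h1, totD_cup_deg ht', totD_int ht, τ.2.2]
    refine Eq.trans ?_ (congrArg (_ + ·) (hm.trans (cup_int _ _).symm).symm)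
    simp only [sparkMulFn, h, hr, map_add, map_neg, map_sub, AddMonoidHom.add_apply,
      AddMonoidHom.neg_apply, smul_add, smul_sub, smul_smul, neg_one_pow_sq, one_smul, pow_succ,
      smul_neg, mul_neg_one, neg_smul]
    abel

theorem sparkMulFn_right {k l : ℕ} (σ : Spark E 𝒰 k) {τ : Spark E 𝒰 l}
    (hτ : τ ∈ trivialSparks E 𝒰 l) : sparkMulFn σ τ ∈ trivialSparks E 𝒰 (k + 1 + l) := by
  obtain ⟨c, hc, t, ht, h, hf, hs⟩ := trivial_spark hτ
  have hr : bi (k + 1) 0 σ.1.2.2.1 ∈ totDeg E 𝒰 ((k + 1 : ℕ) : ℤ) :=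
    bi_mem_totDeg (by simp) _
  refine ⟨cup (bi (k + 1) 0 σ.1.2.2.1) c, ?_, (-1 : ℤ) ^ (k + 1) • cechWedge σ.1.2.2.1 t,
    zsmul_mem (cechWedge_int σ.1.2.2.2 ht) _, ?_⟩
  · have h1 := cup_mem hr hc
    have e : ((k + 1 + l : ℕ) : ℤ) - 1 = ((k + 1 : ℕ) : ℤ) + ((l : ℤ) - 1) := by push_cast; ring
    rw [e]; exact h1
  · rw [map_zsmul]
    refine Eq.trans ?_ (congrArg (fun y => _ + (-1 : ℤ) ^ (k + 1) • y) (cup_int _ _))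
    rw [totD_cup_deg hr, totD_int σ.1.2.2.2, (spark_closed σ).2]
    simp only [sparkMulFn, h, hf, map_zero, map_add, AddMonoidHom.zero_apply, zero_add, smul_add]

/-- The product of the class of `σ` with spark classes. -/
noncomputable def sparkMul {k : ℕ} (l : ℕ) (σ : Spark E 𝒰 k) :
    SparkClass E 𝒰 l →+ SparkClass E 𝒰 (k + 1 + l) :=
  sparkLift ((sparkClass (k + 1 + l)).comp (AddMonoidHom.mk' (sparkMulFn σ)
    (sparkMulFn_add_right σ))) fun _ hτ => sparkClass_eq_zero.2 (sparkMulFn_right σ hτ)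

/-- The product `Ĥ^k × Ĥ^l → Ĥ^(k+l+1)` of spark classes,
`[a] * [b] = [a ∪ f + (-1)^(k+1) r ∪ b]` for `D a = e - r` and `D b = f - s`. -/
noncomputable def sparkProd (k l : ℕ) :
    SparkClass E 𝒰 k →+ SparkClass E 𝒰 l →+ SparkClass E 𝒰 (k + 1 + l) :=
  sparkLift (AddMonoidHom.mk' (sparkMul l) fun σ σ' => AddMonoidHom.ext fun β => by
      obtain ⟨τ, rfl⟩ := sparkClass_surjective l β
      exact (congrArg (sparkClass _) (sparkMulFn_add_left σ σ' τ)).trans (map_add _ _ _))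
    fun σ hσ => AddMonoidHom.ext fun β => by
      obtain ⟨τ, rfl⟩ := sparkClass_surjective l β
      exact sparkClass_eq_zero.2 (sparkMulFn_left hσ τ)

end Sparks

end HyperSpark

/-! Write $Da = e - r$ and $Db = f - s$. The representative $a \cup f + (-1)^{k+1}\, r \cup b$ of
the product has only two terms: the first contains the curvature $f$ of the right factor, the second
the integer cochain $r$ of the left factor. If $f = 0$ and $r = 0$, this element is zero in the
total complex itself, so no element of $F^{k+l}$ or integer cochain is needed to witness that its
class is zero. That is `sparkProd_eq_zero`, and both halves of the theorem are reductions to it.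

On the right nothing has to be arranged. The form $f$ depends only on the class $\beta$, so
$\delta_1\beta = 0$ means $f = 0$ for every representative $b$. On the left, $r$ depends on the
representative: equivalence may change it by the coboundary of an integer cochain. The task is
therefore to find a representative of $\alpha$ whose integer cochain vanishes as a cochain, not only
in cohomology. The product is defined on classes, so such a representative may be used freely.

If $\alpha$ is represented by a global form $w$, then $Dw = dw$ is again a global form. The spark
equation says that the global form $e - dw$, of bidegree $(0, k+1)$, equals $r$, of bidegree $(k+1,
0)$. The bidegrees differ because $k + 1 > 0$, so $r = 0$ already (`int_eq_zero_of_globalForm`).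

If $\delta_2\alpha = 0$, then $r = \delta t$ for an integer cochain $t$ of degree $k$. An
integer-valued smooth function is locally constant, so $dt = 0$ and $Dt = \delta t = r$. Hence $D(a
+ t) = e$, while $a + t$ is equivalent to $a$ (`exists_int_eq_zero_of_delta2`). The new
representative need not be a global form; only the vanishing of its integer cochain matters, so no
partition of unity is involved. -/

namespace HyperSpark

open TopologicalSpace (Opens)

/-! ### Representatives with vanishing integer cochain, and their products with flat classes. -/

section Vanishing

variable {E : Type*} [NormedAddCommGroup E] [NormedSpace ℝ E]
  {X : Type*} [TopologicalSpace X] [ChartedSpace E X] {ι : Type*} {𝒰 : GoodCover X ι}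
  [IsManifold 𝓘(ℝ, E) ∞ X]

/-- The integer cochain of a spark that is a global form vanishes. -/
theorem int_eq_zero_of_globalForm {k : ℕ} {σ : Spark E 𝒰 k} {w : DForm E (⊤ : Opens X) k}
    (h : σ.1.1 = globalForm k w) : σ.1.2.2.1 = 0 := by
  have h1 := σ.2.2
  -- For a global form the Čech part of $D$ vanishes, because the restrictions agree on overlaps.
  -- The spark equation becomes $dw = e - r$ in the total complex.
  rw [h, totD_globalForm] at h1
  -- Rearranged as $e - dw = r$, the equation compares bidegrees $(0, k+1)$ and $(k+1, 0)$. These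
  -- are distinct also for $k = 0$, so both sides vanish. The second component of the conclusion is
  -- $r = 0$; the first would be $e = dw$.
  refine (globalForm_eq_bi (w := σ.1.2.1 - extD w) ?_).2
  rw [map_sub, h1]
  abel

/-- An integer cochain of degree `k`, regarded as a spark. -/
noncomputable def intSpark {k : ℕ} (t : IntCochain E 𝒰 k)
    (ht : cechDelta t.1 ∈ IntCochain E 𝒰 (k + 1)) :
    Spark E 𝒰 k :=
  -- The minus sign comes from the convention $Da = e - r$: since $Dt = \delta t = 0 - (-\delta t)$,
  -- the spark $t$ has $e = 0$ and $r = -\delta t$. The equality $Dt = \delta t$ is `totD_int`,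
  -- where the local constancy of $t$ enters.
  ⟨(bi k 0 t.1, 0, -⟨cechDelta t.1, ht⟩), bi_mem_totDeg (by simp) _, by
    simp [totD_int t.2]⟩

/-- The relation $a - a' = Db + s$ admits any integer cochain as $s$, so $t$ is trivial through $b =
0$ and $s = t$. Adding $t$ to a spark thus leaves the class unchanged but alters the integer cochain
by $-\delta t$; this is the freedom used to remove a coboundary. -/
theorem intSpark_mem_trivialSparks {k : ℕ} (t : IntCochain E 𝒰 k)
    (ht : cechDelta t.1 ∈ IntCochain E 𝒰 (k + 1)) :
    intSpark t ht ∈ trivialSparks E 𝒰 k :=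
  ⟨0, zero_mem _, t.1, t.2, by simp [intSpark]⟩

/-- A class in the kernel of `δ₂` is represented by a spark with vanishing integer cochain. -/
theorem exists_int_eq_zero_of_delta2 {k : ℕ} {α : SparkClass E 𝒰 k}
    (hα : α ∈ (delta2 E 𝒰 k).ker) :
    ∃ σ : Spark E 𝒰 k, sparkClass k σ = α ∧ σ.1.2.2.1 = 0 := by
  obtain ⟨σ, rfl⟩ := sparkClass_surjective k α
  -- By definition $\delta_2$ sends the class of $\sigma$ to the cohomology class of its cocycle
  -- $r$. Its vanishing says that $r$ is a coboundary within the integer cochains, so the primitive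
  -- $t$ is itself integral. A real primitive would not do, since adding it could change the spark
  -- class.
  obtain ⟨t, ht, h⟩ := (QuotientAddGroup.eq_zero_iff (N := intCoboundaries E 𝒰 k)
    ⟨σ.1.2.2, (spark_closed σ).2⟩).1 hα
  have h' : cechDelta t = σ.1.2.2.1 := h
  -- The integrality of $\delta t$ required by `intSpark` is inherited from $r$, to which it is
  -- equal.
  have ht' : cechDelta t ∈ IntCochain E 𝒰 (k + 1) := h' ▸ σ.1.2.2.2
  -- The spark $t$ is added and not subtracted: its integer cochain is $-\delta t = -r$, which
  -- cancels the $r$ of $\sigma$. The form $e$ is left as it was.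
  refine ⟨σ + intSpark ⟨t, ht⟩ ht', ?_, ?_⟩
  · rw [map_add, sparkClass_eq_zero.2 (intSpark_mem_trivialSparks _ _), add_zero]
  · change σ.1.2.2.1 + -cechDelta t = 0
    rw [h', add_neg_cancel]

/-- The product of a class represented by a spark with vanishing integer cochain and a class in the
kernel of `δ₁` is zero. -/
theorem sparkProd_eq_zero [FiniteDimensional ℝ E] {k l : ℕ} {σ : Spark E 𝒰 k}
    (hσ : σ.1.2.2.1 = 0) {β : SparkClass E 𝒰 l} (hβ : β ∈ (delta1 E 𝒰 l).ker) :
    sparkProd k l (sparkClass k σ) β = 0 := by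
  obtain ⟨τ, rfl⟩ := sparkClass_surjective l β
  -- On the class of $\tau$ the map $\delta_1$ evaluates definitionally to the curvature form of
  -- $\tau$. An arbitrary representative of $\beta$ therefore suffices.
  have hτ : τ.1.2.1 = 0 := hβ
  -- A spark is determined by its component in the total complex, so only $a \cup 0 + (-1)^{k+1}\, 0
  -- \cup b = 0$ has to be seen; biadditivity of the cup product gives it. The form and the integer
  -- cochain of the product need no separate check.
  have h : sparkMulFn σ τ = 0 := spark_ext (by simp [sparkMulFn, hσ, hτ])
  -- On the classes of $\sigma$ and $\tau$ the product unfolds to the class of `sparkMulFn σ τ`, so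
  -- the equality of sparks passes to classes.
  exact (congrArg (sparkClass (k + 1 + l)) h).trans (map_zero _)

end Vanishing

end HyperSpark

/-- The two halves differ only in how a representative of $\alpha$ with $r = 0$ is obtained. The
group $H^l(X, \mathbb R/\mathbb Z)$ enters as the kernel of `delta1`. The product lies in degree `k
+ 1 + l`, the form of $k + l + 1$ in which the degrees of $r$ and $b$ add up. -/
theorem lemma5p7 {n : ℕ} {X : Type*} [TopologicalSpace X] [T2Space X] [SecondCountableTopology X]
    [ChartedSpace (EuclideanSpace ℝ (Fin n)) X] [IsManifold (𝓡 n) ∞ X] {ι : Type*}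
    (𝒰 : HyperSpark.GoodCover X ι) (k l : ℕ) :
    (∀ α ∈ HyperSpark.smoothClasses (EuclideanSpace ℝ (Fin n)) 𝒰 k,
      ∀ β ∈ (HyperSpark.delta1 (EuclideanSpace ℝ (Fin n)) 𝒰 l).ker,
        HyperSpark.sparkProd k l α β = 0) ∧
    (∀ α ∈ (HyperSpark.delta2 (EuclideanSpace ℝ (Fin n)) 𝒰 k).ker,
      ∀ β ∈ (HyperSpark.delta1 (EuclideanSpace ℝ (Fin n)) 𝒰 l).ker,
        HyperSpark.sparkProd k l α β = 0) := by
  refine ⟨?_, fun α hα β hβ => ?_⟩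
  -- Membership in `smoothClasses` already supplies the right representative: the global form
  -- itself, with no correction.
  · rintro _ ⟨σ, ⟨w, hw⟩, rfl⟩ β hβ
    exact HyperSpark.sparkProd_eq_zero (HyperSpark.int_eq_zero_of_globalForm hw) hβ
  -- Here the representative has been corrected by an integer cochain; replacing $\alpha$ by its
  -- class is allowed because the product depends on classes only.
  · obtain ⟨σ, rfl, hσ⟩ := HyperSpark.exists_int_eq_zero_of_delta2 hα
    exact HyperSpark.sparkProd_eq_zero hσ hβ
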